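/- \textbf{Theorem.} Let $k>0$ be an integer or half an odd integer and let $p:\mathbb R\to\mathbb R$ be a $C^\infty$ function with $p(\theta+2k\pi)=(-1)^{2k}p(\theta)$. Let $C$ be the closed hedgehog of rotation number $k$ with support function $p$, i.e. the curve $f(\theta)=(p\cos\theta-p'\sin\theta,\;p\sin\theta+p'\cos\theta)$, put $\rho=p+p''$, $\mathbf t(\theta)=(-\sin\theta,\cos\theta)$, $\mathbf n(\theta)=(-\cos\theta,-\sin\theta)$, and let $$\gamma_{\mathrm{SES}}=f+\frac{-\rho^2\rho'\,\mathbf t+\rho^3\,\mathbf n}{\rho^2+\rho'^2}$$ be the parameterization of the singular evolutoids set of $C$. Assume that $C$ is generic: all singular points of $f$ are cusps, all singular points of $\gamma_{\mathrm{SES}}$ are cusps, $\gamma_{\mathrm{SES}}$ has no undulation points (regular points where the curvature vanishes without changing sign), and all its inflexion points (regular points where the curvature changes sign) are non-degenerate, i.e. $\det(\gamma_{\mathrm{SES}}',\gamma_{\mathrm{SES}}''')\ne0$ there. Here a cusp of a plane curve $\gamma$ is a point where $\gamma'=0$ and $\gamma'',\gamma'''$ are linearly independent. Let $M=[0,\pi]\times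 S^1$, where $S^1=\mathbb R/2\tilde k\pi\mathbb Z$ with $\tilde k=k$ if $k$ is an integer and $\tilde k=2k$ otherwise, and let $M$ be oriented by the coordinates $(\alpha,\theta)$. Let the extended evolutoids front $F:M\to\mathbb R\times\mathbb R^2=\mathbb R^3$ and its unit normal $\nu$ be $$F(\alpha,\theta)=\bigl(\alpha,\;f(\theta)+\rho(\theta)\sin\alpha\;\mathbf t(\theta+\alpha)\bigr),\qquad \nu(\alpha,\theta)=\frac{\bigl(-\rho(\theta)\sin\alpha,\;\mathbf n(\theta+\alpha)\bigr)}{\sqrt{1+\rho(\theta)^2\sin^2\alpha}}.$$ Put $\lambda=\det(F_\alpha,F_\theta,\nu)$, let $dA=|\lambda|\,d\alpha\,d\theta$, let $\Sigma\subset M$ be the set of singular points of $F$ (the points where $dF$ is not injective), and let $K$ be the Gaussian curvature of $F$ on $M\setminus\Sigma$. A point of $\Sigma$ is an $A_2$-point if $d\lambda\neq0$ there and the null direction $\ker dF$ is transversal to $\ker d\lambda$. Along a regular arc $\sigma$ in $\Sigma$ that consists of $A_2$-points let $d\tau=|(F\circ\sigma)'|\,dt$, let $e=dF(d\sigma/d\tau)$,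 let $\kappa_g=\det\bigl(e,\,(de/d\tau)^{\perp\nu},\,\nu\bigr)$ be the geodesic curvature, where $(\cdot)^{\perp\nu}$ is the component orthogonal to $\nu$, and let $\kappa_s=\operatorname{sgn}(d\lambda(\eta))\,\kappa_g$ be the singular curvature, where $\eta$ is a null vector such that $(\sigma',\eta)$ is positively oriented. Then $K\,dA$ is integrable on $M$; all but finitely many points of $\Sigma$ lie on finitely many pairwise disjoint embedded regular $C^2$ arcs that consist of $A_2$-points of $\Sigma$; for every such family of arcs $\kappa_s\,d\tau$ is integrable on each arc, and, with $\int_\Sigma\kappa_s\,d\tau$ the sum of its integrals over the arcs, $$\int_M K\,dA=-2\int_\Sigma\kappa_s\,d\tau .$$ -/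

import Mathlib

open Set Filter Topology MeasureTheory
open scoped ContDiff

noncomputable section

/-- The plane `ℝ²`. -/
abbrev Plane := EuclideanSpace ℝ (Fin 2)

/-- The extended space `ℝ × ℝ²` with its Euclidean metric; coordinate `0` is the time `α`. -/
abbrev ExtSpace := EuclideanSpace ℝ (Fin 3)

/-! ### Planar curves -/

namespace PlaneCurve

/-- The determinant of two plane vectors. -/
def det2 (x y : Plane) : ℝ := x 0 * y 1 - x 1 * y 0

/-- A singular point `γ s` is a cusp (locally diffeomorphic to `t ↦ (t², t³)`): the velocity
vanishes and the second and third derivatives are linearly independent. -/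
def IsCusp (γ : ℝ → Plane) (s : ℝ) : Prop :=
  deriv γ s = 0 ∧ LinearIndependent ℝ ![iteratedDeriv 2 γ s, iteratedDeriv 3 γ s]

/-- All singular points of the curve are cusps. -/
def AtMostCusps (γ : ℝ → Plane) : Prop := ∀ s, deriv γ s = 0 → IsCusp γ s

/-- The signed curvature, in an arbitrary parameter. -/
def curvature (γ : ℝ → Plane) (s : ℝ) : ℝ :=
  det2 (deriv γ s) (iteratedDeriv 2 γ s) / ‖deriv γ s‖ ^ 3

/-- The function `g` changes sign at `s`. -/
def ChangesSign (g : ℝ → ℝ) (s : ℝ) : Prop :=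
  ((∀ᶠ x in 𝓝[<] s, g x < 0) ∧ ∀ᶠ x in 𝓝[>] s, 0 < g x) ∨
    ((∀ᶠ x in 𝓝[<] s, 0 < g x) ∧ ∀ᶠ x in 𝓝[>] s, g x < 0)

/-- A regular point at which the curvature changes sign. -/
def IsInflexion (γ : ℝ → Plane) (s : ℝ) : Prop :=
  deriv γ s ≠ 0 ∧ ChangesSign (curvature γ) s

/-- A regular point at which the curvature vanishes without changing sign. -/
def IsUndulation (γ : ℝ → Plane) (s : ℝ) : Prop :=
  deriv γ s ≠ 0 ∧ curvature γ s = 0 ∧ ¬ ChangesSign (curvature γ) s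

/-- The condition for an inflexion point to be non-degenerate. -/
def IsNondegenerate (γ : ℝ → Plane) (s : ℝ) : Prop :=
  det2 (deriv γ s) (iteratedDeriv 3 γ s) ≠ 0

end PlaneCurve

/-! ### Hedgehogs, evolutoids and the singular evolutoids set -/

namespace Hedgehog

/-- The unit tangent vector in polar tangential coordinates. -/
def tangent (θ : ℝ) : Plane := !₂[-Real.sin θ, Real.cos θ]

/-- The unit normal vector in polar tangential coordinates; `(tangent θ, normal θ)` is a
positively oriented frame. -/
def normal (θ : ℝ) : Plane := !₂[-Real.cos θ, -Real.sin θ]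

/-- `p` is the support function of a smooth closed hedgehog with rotation number `k = m / 2`: the
oriented support lines `x cos θ + y sin θ = p θ` at `θ` and at `θ + 2 k π` are the same line
(with the opposite orientation when `k` is not an integer). -/
structure IsSupportFunction (m : ℕ) (p : ℝ → ℝ) : Prop where
  smooth : ContDiff ℝ ∞ p
  closed : ∀ θ, p (θ + m * Real.pi) = (-1) ^ m * p θ

/-- The length of the parameter circle of a hedgehog with rotation number `k = m / 2`: it is
`2 k π` if `k` is an integer, and `4 k π` (the double covering) otherwise. -/
def period (m : ℕ) : ℝ := if Even m then m * Real.pi else 2 * (m * Real.pi)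

/-- The polar tangential parameterization of the hedgehog with support function `p`. -/
def curve (p : ℝ → ℝ) (θ : ℝ) : Plane :=
  !₂[p θ * Real.cos θ - deriv p θ * Real.sin θ, p θ * Real.sin θ + deriv p θ * Real.cos θ]

/-- The (signed) radius of curvature `ρ = p + p''`. -/
def rho (p : ℝ → ℝ) (θ : ℝ) : ℝ := p θ + deriv (deriv p) θ

/-- The parameterization `f + ρ sin α · 𝕥(θ + α)` of the `α`-evolutoid of the hedgehog. -/
def evolutoid (p : ℝ → ℝ) (α θ : ℝ) : Plane :=
  curve p θ + (rho p θ * Real.sin α) • tangent (θ + α)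

/-- The parameterization of the singular evolutoids set,
`f + (- ρ ρ_s 𝕥 + ρ 𝕟) / (1 + ρ_s ^ 2)`, where `ρ_s = ρ' / ρ` is the derivative of the radius of
curvature with respect to arc length. Fractions are cleared so that it also makes sense at the
cusps, where `ρ = 0` and `ρ' ≠ 0`. -/
def singularEvolutoids (p : ℝ → ℝ) (θ : ℝ) : Plane :=
  curve p θ + (rho p θ ^ 2 + deriv (rho p) θ ^ 2)⁻¹ •
    (-(rho p θ ^ 2 * deriv (rho p) θ) • tangent θ + rho p θ ^ 3 • normal θ)

/-- A generic hedgehog: it has at most cusp singularities, and its singular evolutoids set has at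
most cusp singularities, no undulation points and only non-degenerate inflexion points. -/
structure IsGeneric (p : ℝ → ℝ) : Prop where
  curve_cusps : PlaneCurve.AtMostCusps (curve p)
  ses_cusps : PlaneCurve.AtMostCusps (singularEvolutoids p)
  ses_no_undulation : ∀ θ, ¬ PlaneCurve.IsUndulation (singularEvolutoids p) θ
  ses_inflexion : ∀ θ, PlaneCurve.IsInflexion (singularEvolutoids p) θ →
    PlaneCurve.IsNondegenerate (singularEvolutoids p) θ

/-- The extended evolutoids front `(α, θ) ↦ (α, f_α(θ))`. It is written on the universal cover of
`[0, π] × S¹`, and it is periodic in `θ`. -/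
def front (p : ℝ → ℝ) (q : ℝ × ℝ) : ExtSpace :=
  !₂[q.1, evolutoid p q.1 q.2 0, evolutoid p q.1 q.2 1]

/-- The unit normal vector field of the extended evolutoids front. -/
def frontNormal (p : ℝ → ℝ) (q : ℝ × ℝ) : ExtSpace :=
  (Real.sqrt (1 + rho p q.2 ^ 2 * Real.sin q.1 ^ 2))⁻¹ •
    !₂[-(rho p q.2 * Real.sin q.1), normal (q.2 + q.1) 0, normal (q.2 + q.1) 1]

end Hedgehog

/-! ### Geometry of a front `F` with unit normal `ν`

The coherent tangent bundle of the front has the fibre `ν(q)^⊥` over `q`, the Euclidean metric, the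
tangential part of the derivative as connection, and `ψ = dF`. The coordinates `(u, v)` are
positively oriented. -/

namespace FrontGeometry

/-- The determinant of three vectors of the extended space. -/
def det3 (x y z : ExtSpace) : ℝ :=
  Matrix.det !![x 0, x 1, x 2; y 0, y 1, y 2; z 0, z 1, z 2]

/-- The partial derivative with respect to the first coordinate. -/
def partialU (F : ℝ × ℝ → ExtSpace) (q : ℝ × ℝ) : ExtSpace := fderiv ℝ F q (1, 0)

/-- The partial derivative with respect to the second coordinate. -/
def partialV (F : ℝ × ℝ → ExtSpace) (q : ℝ × ℝ) : ExtSpace := fderiv ℝ F q (0, 1)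

/-- The signed area density `λ = μ(∂_u, ∂_v)`, where `μ(x, y) = det (x, y, ν)`. -/
def areaDensity (F ν : ℝ × ℝ → ExtSpace) (q : ℝ × ℝ) : ℝ :=
  det3 (partialU F q) (partialV F q) (ν q)

/-- The Gaussian curvature `(LN - M²) / (EG - F²)` (used at non-singular points only). -/
def gaussianCurvature (F ν : ℝ × ℝ → ExtSpace) (q : ℝ × ℝ) : ℝ :=
  (inner ℝ (partialU (partialU F) q) (ν q) * inner ℝ (partialV (partialV F) q) (ν q)
      - inner ℝ (partialV (partialU F) q) (ν q) ^ 2) /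
    (inner ℝ (partialU F q) (partialU F q) * inner ℝ (partialV F q) (partialV F q)
      - inner ℝ (partialU F q) (partialV F q) ^ 2)

/-- A singular point: `ψ = dF` is not a bijection from the tangent plane onto the fibre. -/
def IsSingular (F : ℝ × ℝ → ExtSpace) (q : ℝ × ℝ) : Prop :=
  ¬ Function.Injective (fderiv ℝ F q)

/-- An `A₂`-point: a singular point with `dλ ≠ 0` such that the null direction is transversal to
the singular direction `ker dλ`. -/
def IsA2Point (F ν : ℝ × ℝ → ExtSpace) (q : ℝ × ℝ) : Prop :=
  IsSingular F q ∧ fderiv ℝ (areaDensity F ν) q ≠ 0 ∧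
    ∀ η : ℝ × ℝ, η ≠ 0 → fderiv ℝ F q η = 0 → fderiv ℝ (areaDensity F ν) q η ≠ 0

/-- The vector `ψ(σ')` along a curve `σ`. -/
def velocity (F : ℝ × ℝ → ExtSpace) (σ : ℝ → ℝ × ℝ) (t : ℝ) : ExtSpace :=
  fderiv ℝ F (σ t) (deriv σ t)

/-- The speed `|ψ(σ')|`, so that the arc length element is `dτ = |ψ(σ')| dt`. -/
def speed (F : ℝ × ℝ → ExtSpace) (σ : ℝ → ℝ × ℝ) (t : ℝ) : ℝ := ‖velocity F σ t‖

/-- The vector `ψ(dσ/dτ)`, where `τ` is the arc length parameter. -/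
def unitTangent (F : ℝ × ℝ → ExtSpace) (σ : ℝ → ℝ × ℝ) (t : ℝ) : ExtSpace :=
  (speed F σ t)⁻¹ • velocity F σ t

/-- The covariant derivative `D_{d/dt} ξ` of a section `ξ` along `σ`: the component of `ξ'`
orthogonal to `ν`. -/
def covDeriv (ν : ℝ × ℝ → ExtSpace) (σ : ℝ → ℝ × ℝ) (ξ : ℝ → ExtSpace) (t : ℝ) : ExtSpace :=
  deriv ξ t - (inner ℝ (deriv ξ t) (ν (σ t)) : ℝ) • ν (σ t)

/-- The geodesic curvature `κ_g = μ(ψ(dσ/dτ), D_{d/dτ} ψ(dσ/dτ))`, where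
`d/dτ = |ψ(σ')|⁻¹ d/dt`. -/
def geodesicCurvature (F ν : ℝ × ℝ → ExtSpace) (σ : ℝ → ℝ × ℝ) (t : ℝ) : ℝ :=
  det3 (unitTangent F σ t) ((speed F σ t)⁻¹ • covDeriv ν σ (unitTangent F σ) t) (ν (σ t))

/-- `η` is a null vector at `σ t` such that `(σ', η)` is positively oriented. -/
def IsPositiveNull (F : ℝ × ℝ → ExtSpace) (σ : ℝ → ℝ × ℝ) (t : ℝ) (η : ℝ × ℝ) : Prop :=
  fderiv ℝ F (σ t) η = 0 ∧ 0 < (deriv σ t).1 * η.2 - (deriv σ t).2 * η.1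

open Classical in
/-- The singular curvature `κ_s = sgn (dλ(η)) κ_g` of a singular curve consisting of `A₂`-points,
where `η` is a null vector such that `(σ', η)` is positively oriented. All such `η` are positive
multiples of each other. -/
def singularCurvature (F ν : ℝ × ℝ → ExtSpace) (σ : ℝ → ℝ × ℝ) (t : ℝ) : ℝ :=
  if h : ∃ η, IsPositiveNull F σ t η then
    Real.sign (fderiv ℝ (areaDensity F ν) (σ t) h.choose) * geodesicCurvature F ν σ t
  else 0

/-- The projection from the universal cover of the annulus to `ℝ × S¹`, with `S¹ = ℝ / Tℤ`. -/
def toAnnulus (T : ℝ) (q : ℝ × ℝ) : ℝ × AddCircle T := (q.1, (q.2 : AddCircle T))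

/-- The singular points with `u ∈ [0, π]`, in the universal cover. -/
def singularSet (F : ℝ × ℝ → ExtSpace) : Set (ℝ × ℝ) :=
  {q | q.1 ∈ Icc 0 Real.pi ∧ IsSingular F q}

/-- A parameterization of the singular set `Σ` of a front over `[0, π] × ℝ / Tℤ`: finitely many
pairwise disjoint embedded regular arcs (given by lifts to the universal cover) that consist of
`A₂`-points and together contain all but finitely many points of `Σ`. -/
structure SingularArcs (F ν : ℝ × ℝ → ExtSpace) (T : ℝ) where
  num : ℕ
  lo : Fin num → ℝ
  hi : Fin num → ℝ
  arc : Fin num → ℝ → ℝ × ℝ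
  lo_lt_hi : ∀ i, lo i < hi i
  contDiff : ∀ i, ContDiffOn ℝ 2 (arc i) (Ioo (lo i) (hi i))
  regular : ∀ i, ∀ t ∈ Ioo (lo i) (hi i), deriv (arc i) t ≠ 0
  mem : ∀ i, ∀ t ∈ Ioo (lo i) (hi i), arc i t ∈ singularSet F
  isA2Point : ∀ i, ∀ t ∈ Ioo (lo i) (hi i), IsA2Point F ν (arc i t)
  inj : ∀ i j, ∀ t ∈ Ioo (lo i) (hi i), ∀ s ∈ Ioo (lo j) (hi j),
    toAnnulus T (arc i t) = toAnnulus T (arc j s) → i = j ∧ t = s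
  cover : (toAnnulus T '' singularSet F \
    ⋃ i, toAnnulus T '' (arc i '' Ioo (lo i) (hi i))).Finite

/-- The density `κ_s dτ / dt` along the arc with index `i`. -/
def SingularArcs.density {F ν : ℝ × ℝ → ExtSpace} {T : ℝ} (S : SingularArcs F ν T)
    (i : Fin S.num) (t : ℝ) : ℝ :=
  singularCurvature F ν (S.arc i) t * speed F (S.arc i) t

/-- The total singular curvature `∫_Σ κ_s dτ`. -/
def SingularArcs.totalCurvature {F ν : ℝ × ℝ → ExtSpace} {T : ℝ} (S : SingularArcs F ν T) : ℝ :=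
  ∑ i, ∫ t in Ioo (S.lo i) (S.hi i), S.density i t

/-- A fundamental domain of `[0, π] × ℝ / Tℤ` in the universal cover. -/
def fundamentalDomain (T : ℝ) : Set (ℝ × ℝ) := Icc 0 Real.pi ×ˢ Ico 0 T

/-- The density of `K dA = K |λ| du dv`. -/
def curvatureDensity (F ν : ℝ × ℝ → ExtSpace) (q : ℝ × ℝ) : ℝ :=
  gaussianCurvature F ν q * |areaDensity F ν q|

end FrontGeometry

end

/-! ### Calculus for vector valued functions -/

/-! Both sides reduce to integrals over one period of `θ`, and their integrands differ by an exact
derivative.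

Write `c = ρ cos α + ρ' sin α` and `w = √(1 + ρ² sin² α)`. Then `F_θ = c · (0, 𝕥(θ + α))`, while
`F_α` has first coordinate `1`. Hence `λ = c w`, the singular set is `c = 0`, and the null direction
is `∂_θ`. The second fundamental form satisfies `LN - M² = c (2ρ cos α - c) / w²` and `EG - F² = c²
w²`, so `K dA` has the bounded density `sgn(c) (ρ cos α - ρ' sin α) / w³`
(`curvatureDensity_front`). For fixed `θ` the function `c` is a sine of `α` with one sign change on
`[0, π]`, and the density has an elementary primitive on either side
(`integral_sign_mul_curvature`). Integrating over `α` leaves an explicit function `J` of `ρ` and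
`ρ'`.

On any admissible arc `κ_s dτ = -singularDensity |dθ|` (`singularCurvature_mul_speed`). Since `(ρ,
ρ')` never vanishes, each `θ` has exactly one singular `α` in the open interval if it has any there.
The arcs stay in `0 < α < π`, so their `θ`-coordinates run once over the circle up to finitely many
points (`totalCurvature_front`, `sum_integral_arcs`). Thus the total does not depend on the choice
of arcs.

Finally `2 · singularDensity - J` is four times the derivative of the periodic function `arctan (ρ
ρ' / √(ρ² + ρ'² + ρ⁴))`, whose integral over a period is zero.

Genericity enters through the cusps: those of the hedgehog give `(ρ, ρ') ≠ 0` (`rho_regular`), and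
those of the singular evolutoids set make the zeros of `ρ (ρ ρ'' - ρ'²)` simple, hence finite in
number, which yields the existence of the arcs (`nonempty_singularArcs_front`). -/

theorem HasDerivAt.vec2 {f g : ℝ → ℝ} {f' g' t : ℝ} (hf : HasDerivAt f f' t)
    (hg : HasDerivAt g g' t) :
    HasDerivAt (fun s => (!₂[f s, g s] : Plane)) !₂[f', g'] t := by
  have h : HasDerivAt (fun s => ![f s, g s]) ![f', g'] t := by
    rw [hasDerivAt_pi]
    intro i
    fin_cases i <;> assumption
  exact (PiLp.continuousLinearEquiv 2 ℝ fun _ : Fin 2 => ℝ).symm.hasFDerivAt.comp_hasDerivAt t h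

theorem HasDerivAt.vec3 {f g h : ℝ → ℝ} {f' g' h' t : ℝ} (hf : HasDerivAt f f' t)
    (hg : HasDerivAt g g' t) (hh : HasDerivAt h h' t) :
    HasDerivAt (fun s => (!₂[f s, g s, h s] : ExtSpace)) !₂[f', g', h'] t := by
  have h : HasDerivAt (fun s => ![f s, g s, h s]) ![f', g', h'] t := by
    rw [hasDerivAt_pi]
    intro i
    fin_cases i <;> assumption
  exact (PiLp.continuousLinearEquiv 2 ℝ fun _ : Fin 3 => ℝ).symm.hasFDerivAt.comp_hasDerivAt t h

theorem Differentiable.vec3 {E : Type*} [NormedAddCommGroup E] [NormedSpace ℝ E] {f g h : E → ℝ}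
    (hf : Differentiable ℝ f) (hg : Differentiable ℝ g) (hh : Differentiable ℝ h) :
    Differentiable ℝ fun s => (!₂[f s, g s, h s] : ExtSpace) := by
  rw [differentiable_euclidean]
  intro i
  fin_cases i <;> assumption

theorem fderiv_apply_fst_eq {E : Type*} [NormedAddCommGroup E] [NormedSpace ℝ E] {F : ℝ × ℝ → E}
    {q : ℝ × ℝ} {d : E} (hF : DifferentiableAt ℝ F q)
    (h : HasDerivAt (fun s => F (s, q.2)) d q.1) : fderiv ℝ F q (1, 0) = d :=
  (hF.hasFDerivAt.comp_hasDerivAt (f := fun s => (s, q.2)) q.1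
    ((hasDerivAt_id q.1).prodMk (hasDerivAt_const q.1 q.2))).unique h

theorem fderiv_apply_snd_eq {E : Type*} [NormedAddCommGroup E] [NormedSpace ℝ E] {F : ℝ × ℝ → E}
    {q : ℝ × ℝ} {d : E} (hF : DifferentiableAt ℝ F q)
    (h : HasDerivAt (fun s => F (q.1, s)) d q.2) : fderiv ℝ F q (0, 1) = d :=
  (hF.hasFDerivAt.comp_hasDerivAt (f := fun s => (q.1, s)) q.2
    ((hasDerivAt_const q.2 q.1).prodMk (hasDerivAt_id q.2))).unique h

theorem fderiv_apply_prod {E : Type*} [NormedAddCommGroup E] [NormedSpace ℝ E] (F : ℝ × ℝ → E)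
    (q v : ℝ × ℝ) :
    fderiv ℝ F q v = v.1 • fderiv ℝ F q (1, 0) + v.2 • fderiv ℝ F q (0, 1) := by
  rw [← map_smul, ← map_smul, ← map_add]
  simp

theorem inner_extSpace (x y : ExtSpace) :
    (inner ℝ x y : ℝ) = x 0 * y 0 + x 1 * y 1 + x 2 * y 2 := by
  simp [PiLp.inner_apply, Fin.sum_univ_three, mul_comm]

namespace Hedgehog

/-! ### The support function -/

section Support

variable {m : ℕ} {p : ℝ → ℝ}

theorem IsSupportFunction.differentiable (hp : IsSupportFunction m p) : Differentiable ℝ p :=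
  hp.smooth.differentiable (by simp)

theorem IsSupportFunction.contDiff_deriv (hp : IsSupportFunction m p) : ContDiff ℝ ∞ (deriv p) :=
  (contDiff_infty_iff_deriv.1 hp.smooth).2

theorem IsSupportFunction.contDiff_rho (hp : IsSupportFunction m p) : ContDiff ℝ ∞ (rho p) :=
  hp.smooth.add (contDiff_infty_iff_deriv.1 hp.contDiff_deriv).2

theorem hasDerivAt_of_contDiff {f : ℝ → ℝ} (hf : ContDiff ℝ ∞ f) (x : ℝ) :
    HasDerivAt f (deriv f x) x :=
  (hf.differentiable (by simp) x).hasDerivAt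

theorem contDiff_deriv_of_contDiff {f : ℝ → ℝ} (hf : ContDiff ℝ ∞ f) : ContDiff ℝ ∞ (deriv f) :=
  (contDiff_infty_iff_deriv.1 hf).2

theorem periodic_deriv {f : ℝ → ℝ} {T : ℝ} (hf : Function.Periodic f T) :
    Function.Periodic (deriv f) T := by
  intro x
  rw [← deriv_comp_add_const, funext hf]

theorem IsSupportFunction.periodic (hp : IsSupportFunction m p) :
    Function.Periodic p (period m) := by
  intro θ
  unfold period
  split_ifs with h
  · rw [hp.closed, h.neg_one_pow, one_mul]
  · rw [two_mul, ← add_assoc, hp.closed, hp.closed, (Nat.not_even_iff_odd.1 h).neg_one_pow]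
    ring

theorem IsSupportFunction.periodic_rho (hp : IsSupportFunction m p) :
    Function.Periodic (rho p) (period m) := by
  intro θ
  simp only [rho]
  rw [hp.periodic, periodic_deriv (periodic_deriv hp.periodic)]

theorem period_pos (hm : 0 < m) : 0 < period m := by
  unfold period
  split_ifs <;> positivity

end Support

/-! ### The front -/

/-- The function whose zeros are the singular points of the front. -/
noncomputable def singularFunction (ρ : ℝ → ℝ) (q : ℝ × ℝ) : ℝ :=
  ρ q.2 * Real.cos q.1 + deriv ρ q.2 * Real.sin q.1

/-- The length of the unnormalized normal vector of the front. -/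
noncomputable def normalLength (ρ : ℝ → ℝ) (q : ℝ × ℝ) : ℝ :=
  Real.sqrt (1 + ρ q.2 ^ 2 * Real.sin q.1 ^ 2)

/-- The derivative of the front in the direction of the time `α`. -/
noncomputable def frontU (ρ : ℝ → ℝ) (q : ℝ × ℝ) : ExtSpace :=
  !₂[1, -(ρ q.2 * Real.sin (q.2 + 2 * q.1)), ρ q.2 * Real.cos (q.2 + 2 * q.1)]

/-- The derivative of the front in the direction of the parameter `θ` of the hedgehog. -/
noncomputable def frontV (ρ : ℝ → ℝ) (q : ℝ × ℝ) : ExtSpace :=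
  !₂[0, -(singularFunction ρ q * Real.sin (q.2 + q.1)),
    singularFunction ρ q * Real.cos (q.2 + q.1)]

theorem normalLength_pos (ρ : ℝ → ℝ) (q : ℝ × ℝ) : 0 < normalLength ρ q :=
  Real.sqrt_pos.2 (by positivity)

theorem sq_normalLength (ρ : ℝ → ℝ) (q : ℝ × ℝ) :
    normalLength ρ q ^ 2 = 1 + ρ q.2 ^ 2 * Real.sin q.1 ^ 2 :=
  Real.sq_sqrt (by positivity)

section Smooth

variable {ρ : ℝ → ℝ}

theorem differentiable_singularFunction (hρ : ContDiff ℝ ∞ ρ) :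
    Differentiable ℝ (singularFunction ρ) := by
  have h0 := hρ.differentiable (by simp)
  have h1 := (contDiff_deriv_of_contDiff hρ).differentiable (by simp)
  unfold singularFunction
  fun_prop

theorem differentiable_normalLength (hρ : ContDiff ℝ ∞ ρ) :
    Differentiable ℝ (normalLength ρ) := by
  have h0 := hρ.differentiable (by simp)
  unfold normalLength
  intro q
  refine DifferentiableAt.sqrt (by fun_prop) (by positivity)

theorem differentiable_frontU (hρ : ContDiff ℝ ∞ ρ) : Differentiable ℝ (frontU ρ) := by
  have h0 := hρ.differentiable (by simp)
  unfold frontU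
  apply Differentiable.vec3 <;> fun_prop

theorem differentiable_frontV (hρ : ContDiff ℝ ∞ ρ) : Differentiable ℝ (frontV ρ) := by
  have h0 := differentiable_singularFunction hρ
  unfold frontV
  apply Differentiable.vec3 <;> fun_prop

theorem hasDerivAt_singularFunction_fst (q : ℝ × ℝ) :
    HasDerivAt (fun s => singularFunction ρ (s, q.2))
      (-(ρ q.2 * Real.sin q.1) + deriv ρ q.2 * Real.cos q.1) q.1 := by
  convert! ((Real.hasDerivAt_cos q.1).const_mul (ρ q.2)).add
    ((Real.hasDerivAt_sin q.1).const_mul (deriv ρ q.2)) using 1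
  ring

theorem hasDerivAt_singularFunction_snd (hρ : ContDiff ℝ ∞ ρ) (q : ℝ × ℝ) :
    HasDerivAt (fun s => singularFunction ρ (q.1, s))
      (deriv ρ q.2 * Real.cos q.1 + deriv (deriv ρ) q.2 * Real.sin q.1) q.2 :=
  ((hasDerivAt_of_contDiff hρ q.2).mul_const (Real.cos q.1)).add
    ((hasDerivAt_of_contDiff (contDiff_deriv_of_contDiff hρ) q.2).mul_const (Real.sin q.1))

end Smooth

section Front

variable {m : ℕ} {p : ℝ → ℝ}

theorem front_eq (p : ℝ → ℝ) : front p = fun q : ℝ × ℝ =>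
    !₂[q.1,
      p q.2 * Real.cos q.2 - deriv p q.2 * Real.sin q.2
        - rho p q.2 * Real.sin q.1 * Real.sin (q.2 + q.1),
      p q.2 * Real.sin q.2 + deriv p q.2 * Real.cos q.2
        + rho p q.2 * Real.sin q.1 * Real.cos (q.2 + q.1)] := by
  funext q
  simp [front, evolutoid, curve, tangent, sub_eq_add_neg]

theorem differentiable_front (hp : IsSupportFunction m p) : Differentiable ℝ (front p) := by
  have h0 := hp.differentiable
  have h1 := hp.contDiff_deriv.differentiable (by simp)
  have h2 := hp.contDiff_rho.differentiable (by simp)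
  rw [front_eq]
  apply Differentiable.vec3 <;> fun_prop

theorem partialU_front (hp : IsSupportFunction m p) :
    FrontGeometry.partialU (front p) = frontU (rho p) := by
  funext q
  refine fderiv_apply_fst_eq (differentiable_front hp q) ?_
  rw [front_eq]
  have hs := Real.hasDerivAt_sin q.1
  have hb : HasDerivAt (fun s => q.2 + s) 1 q.1 := (hasDerivAt_id q.1).const_add q.2
  refine HasDerivAt.vec3 (hasDerivAt_id q.1) ?_ ?_
  · convert! (((hs.const_mul (rho p q.2)).mul hb.sin).const_sub
      (p q.2 * Real.cos q.2 - deriv p q.2 * Real.sin q.2)) using 1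
    rw [show q.2 + 2 * q.1 = (q.2 + q.1) + q.1 by ring, Real.sin_add]
    ring
  · convert! (((hs.const_mul (rho p q.2)).mul hb.cos).const_add
      (p q.2 * Real.sin q.2 + deriv p q.2 * Real.cos q.2)) using 1
    rw [show q.2 + 2 * q.1 = (q.2 + q.1) + q.1 by ring, Real.cos_add]
    ring

theorem partialV_front (hp : IsSupportFunction m p) :
    FrontGeometry.partialV (front p) = frontV (rho p) := by
  funext q
  refine fderiv_apply_snd_eq (differentiable_front hp q) ?_
  rw [front_eq]
  have h0 := hasDerivAt_of_contDiff hp.smooth q.2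
  have h1 := hasDerivAt_of_contDiff hp.contDiff_deriv q.2
  have h2 := hasDerivAt_of_contDiff hp.contDiff_rho q.2
  have hb : HasDerivAt (fun s => s + q.1) 1 q.2 := (hasDerivAt_id q.2).add_const q.1
  have hθ : q.2 = (q.2 + q.1) - q.1 := by ring
  have hsin : Real.sin q.2 =
      Real.sin (q.2 + q.1) * Real.cos q.1 - Real.cos (q.2 + q.1) * Real.sin q.1 := by
    rw [← Real.sin_sub, ← hθ]
  have hcos : Real.cos q.2 =
      Real.cos (q.2 + q.1) * Real.cos q.1 + Real.sin (q.2 + q.1) * Real.sin q.1 := by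
    rw [← Real.cos_sub, ← hθ]
  have hr : deriv (deriv p) q.2 = rho p q.2 - p q.2 := by simp [rho]
  refine HasDerivAt.vec3 (hasDerivAt_const _ _) ?_ ?_
  · convert! ((h0.mul (Real.hasDerivAt_cos q.2)).sub (h1.mul (Real.hasDerivAt_sin q.2))).sub
      ((h2.mul_const (Real.sin q.1)).mul hb.sin) using 1
    rw [singularFunction, hr]
    linear_combination (rho p q.2) * hsin
  · convert! ((h0.mul (Real.hasDerivAt_sin q.2)).add (h1.mul (Real.hasDerivAt_cos q.2))).add
      ((h2.mul_const (Real.sin q.1)).mul hb.cos) using 1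
    rw [singularFunction, hr]
    linear_combination (-rho p q.2) * hcos

theorem partialU_frontU (hρ : ContDiff ℝ ∞ (rho p)) (q : ℝ × ℝ) :
    FrontGeometry.partialU (frontU (rho p)) q =
      !₂[0, -(2 * rho p q.2 * Real.cos (q.2 + 2 * q.1)),
        -(2 * rho p q.2 * Real.sin (q.2 + 2 * q.1))] := by
  refine fderiv_apply_fst_eq (differentiable_frontU hρ q) ?_
  have hb : HasDerivAt (fun s => q.2 + 2 * s) 2 q.1 := by
    simpa using ((hasDerivAt_id q.1).const_mul 2).const_add q.2
  refine HasDerivAt.vec3 (hasDerivAt_const _ _) ?_ ?_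
  · convert! (hb.sin.const_mul (rho p q.2)).neg using 1
    ring
  · convert! (hb.cos.const_mul (rho p q.2)) using 1
    ring

theorem partialV_frontU (hρ : ContDiff ℝ ∞ (rho p)) (q : ℝ × ℝ) :
    FrontGeometry.partialV (frontU (rho p)) q =
      !₂[0, -(deriv (rho p) q.2 * Real.sin (q.2 + 2 * q.1)
          + rho p q.2 * Real.cos (q.2 + 2 * q.1)),
        deriv (rho p) q.2 * Real.cos (q.2 + 2 * q.1)
          - rho p q.2 * Real.sin (q.2 + 2 * q.1)] := by
  refine fderiv_apply_snd_eq (differentiable_frontU hρ q) ?_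
  have hb : HasDerivAt (fun s => s + 2 * q.1) 1 q.2 := (hasDerivAt_id q.2).add_const _
  have h2 := hasDerivAt_of_contDiff hρ q.2
  refine HasDerivAt.vec3 (hasDerivAt_const _ _) ?_ ?_
  · convert! (h2.mul hb.sin).neg using 1
    ring
  · convert! (h2.mul hb.cos) using 1
    ring

/-- The coefficient `d` multiplies the direction `(0, 𝕥(θ + α))`, which is orthogonal to the normal.
It drops out of the second fundamental form and is therefore left unspecified. -/
theorem partialV_frontV (hρ : ContDiff ℝ ∞ (rho p)) (q : ℝ × ℝ) :
    ∃ d, FrontGeometry.partialV (frontV (rho p)) q =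
      !₂[0, -(d * Real.sin (q.2 + q.1)
          + singularFunction (rho p) q * Real.cos (q.2 + q.1)),
        d * Real.cos (q.2 + q.1)
          - singularFunction (rho p) q * Real.sin (q.2 + q.1)] := by
  refine ⟨deriv (rho p) q.2 * Real.cos q.1 + deriv (deriv (rho p)) q.2 * Real.sin q.1,
    fderiv_apply_snd_eq (differentiable_frontV hρ q) ?_⟩
  have hb : HasDerivAt (fun s => s + q.1) 1 q.2 := (hasDerivAt_id q.2).add_const _
  have h2 := hasDerivAt_singularFunction_snd hρ q
  refine HasDerivAt.vec3 (hasDerivAt_const _ _) ?_ ?_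
  · convert! (h2.mul hb.sin).neg using 1
    ring
  · convert! (h2.mul hb.cos) using 1
    ring

theorem frontNormal_eq (p : ℝ → ℝ) (q : ℝ × ℝ) : frontNormal p q =
    (normalLength (rho p) q)⁻¹ • !₂[-(rho p q.2 * Real.sin q.1), -Real.cos (q.2 + q.1),
      -Real.sin (q.2 + q.1)] := rfl

end Front


/-! ### The singular set and the Gaussian curvature of the front -/

section FrontGeometry

open FrontGeometry

variable {m : ℕ} {p : ℝ → ℝ}

/-- The unnormalized normal is the cross product of `F_α` with `(0, 𝕥(θ + α))`, and `F_θ` is the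
latter vector times the singular function. The determinant is thus that factor times the length of
the cross product. -/
theorem det3_frontU_frontV_frontNormal (p : ℝ → ℝ) (q : ℝ × ℝ) :
    det3 (frontU (rho p) q) (frontV (rho p) q) (frontNormal p q) =
      singularFunction (rho p) q * normalLength (rho p) q := by
  have hw := normalLength_pos (rho p) q
  have hw2 := sq_normalLength (rho p) q
  rw [frontNormal_eq, det3, Matrix.det_fin_three, frontU, frontV,
    show q.2 + 2 * q.1 = (q.2 + q.1) + q.1 by ring, Real.sin_add (q.2 + q.1),
    Real.cos_add (q.2 + q.1)]
  simp
  field_simp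
  rw [hw2]
  have h1 := Real.sin_sq_add_cos_sq (q.2 + q.1)
  linear_combination (singularFunction (rho p) q +
    singularFunction (rho p) q * rho p q.2 ^ 2 * Real.sin q.1 ^ 2) * h1

theorem areaDensity_front (hp : IsSupportFunction m p) :
    areaDensity (front p) (frontNormal p) =
      fun q => singularFunction (rho p) q * normalLength (rho p) q := by
  funext q
  rw [areaDensity, partialU_front hp, partialV_front hp, det3_frontU_frontV_frontNormal]

/-- One factor of the singular function cancels in `K` and the other against `|λ|`, leaving only its
sign. This removes the singularity of `K` and gives a bounded density. -/
theorem curvatureDensity_front (hp : IsSupportFunction m p) (q : ℝ × ℝ) :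
    curvatureDensity (front p) (frontNormal p) q =
      SignType.sign (singularFunction (rho p) q) *
        ((rho p q.2 * Real.cos q.1 - deriv (rho p) q.2 * Real.sin q.1) /
          normalLength (rho p) q ^ 3) := by
  have hw := normalLength_pos (rho p) q
  have hw2 := sq_normalLength (rho p) q
  obtain ⟨d, hd⟩ := partialV_frontV hp.contDiff_rho q
  have h1 := Real.sin_sq_add_cos_sq (q.2 + q.1)
  have h2 := Real.sin_sq_add_cos_sq q.1
  have hL : (inner ℝ (partialU (partialU (front p)) q) (frontNormal p q) : ℝ) =
      2 * rho p q.2 * Real.cos q.1 / normalLength (rho p) q := by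
    rw [partialU_front hp, partialU_frontU hp.contDiff_rho, frontNormal_eq, inner_extSpace,
      show q.2 + 2 * q.1 = (q.2 + q.1) + q.1 by ring, Real.sin_add (q.2 + q.1),
      Real.cos_add (q.2 + q.1)]
    simp
    field_simp
    linear_combination (rho p q.2 * Real.cos q.1) * h1
  have hN : (inner ℝ (partialV (partialV (front p)) q) (frontNormal p q) : ℝ) =
      singularFunction (rho p) q / normalLength (rho p) q := by
    rw [partialV_front hp, hd, frontNormal_eq, inner_extSpace]
    simp
    field_simp
    linear_combination (singularFunction (rho p) q) * h1
  have hM : (inner ℝ (partialV (partialU (front p)) q) (frontNormal p q) : ℝ) =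
      singularFunction (rho p) q / normalLength (rho p) q := by
    rw [partialU_front hp, partialV_frontU hp.contDiff_rho, frontNormal_eq, inner_extSpace,
      show q.2 + 2 * q.1 = (q.2 + q.1) + q.1 by ring, Real.sin_add (q.2 + q.1),
      Real.cos_add (q.2 + q.1), singularFunction]
    simp
    field_simp
    linear_combination (rho p q.2 * Real.cos q.1 + deriv (rho p) q.2 * Real.sin q.1) * h1
  have hE : (inner ℝ (partialU (front p) q) (partialU (front p) q) : ℝ) = 1 + rho p q.2 ^ 2 := by
    rw [partialU_front hp, inner_extSpace, frontU]
    simp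
    linear_combination (rho p q.2 ^ 2) * Real.sin_sq_add_cos_sq (q.2 + 2 * q.1)
  have hF : (inner ℝ (partialU (front p) q) (partialV (front p) q) : ℝ) =
      singularFunction (rho p) q * rho p q.2 * Real.cos q.1 := by
    rw [partialU_front hp, partialV_front hp, inner_extSpace, frontU, frontV,
      show q.2 + 2 * q.1 = (q.2 + q.1) + q.1 by ring, Real.sin_add (q.2 + q.1),
      Real.cos_add (q.2 + q.1)]
    simp
    linear_combination (singularFunction (rho p) q * rho p q.2 * Real.cos q.1) * h1
  have hG : (inner ℝ (partialV (front p) q) (partialV (front p) q) : ℝ) =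
      singularFunction (rho p) q ^ 2 := by
    rw [partialV_front hp, inner_extSpace, frontV]
    simp
    linear_combination (singularFunction (rho p) q ^ 2) * h1
  have hden : (1 + rho p q.2 ^ 2) * singularFunction (rho p) q ^ 2
      - (singularFunction (rho p) q * rho p q.2 * Real.cos q.1) ^ 2 =
      singularFunction (rho p) q ^ 2 * normalLength (rho p) q ^ 2 := by
    rw [hw2]
    linear_combination (-singularFunction (rho p) q ^ 2 * rho p q.2 ^ 2) * h2
  rw [curvatureDensity, gaussianCurvature, hL, hN, hM, hE, hF, hG, hden, areaDensity_front hp]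
  simp only [abs_mul, abs_of_pos hw]
  rcases eq_or_ne (singularFunction (rho p) q) 0 with h0 | h0
  -- At a singular point both sides are zero, because the area density and `sign 0` vanish. The
  -- formula therefore holds on the whole annulus and no null set has to be removed.
  · simp [h0]
  · have key : 2 * rho p q.2 * Real.cos q.1 - singularFunction (rho p) q =
        rho p q.2 * Real.cos q.1 - deriv (rho p) q.2 * Real.sin q.1 := by
      rw [singularFunction]
      ring
    rw [← key]
    rcases lt_or_gt_of_ne h0 with h | h
    · rw [abs_of_neg h, sign_neg h]
      field_simp
      simp
    · rw [abs_of_pos h, sign_pos h]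
      field_simp
      simp

theorem fderiv_front_snd (hp : IsSupportFunction m p) (q : ℝ × ℝ) :
    fderiv ℝ (front p) q (0, 1) = frontV (rho p) q :=
  congrFun (partialV_front hp) q

theorem fderiv_front_apply (hp : IsSupportFunction m p) (q v : ℝ × ℝ) :
    fderiv ℝ (front p) q v = v.1 • frontU (rho p) q + v.2 • frontV (rho p) q := by
  rw [fderiv_apply_prod, ← partialU_front hp, ← partialV_front hp]
  rfl

theorem frontV_eq_zero {ρ : ℝ → ℝ} {q : ℝ × ℝ} (h : singularFunction ρ q = 0) :
    frontV ρ q = 0 := by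
  rw [frontV, h]
  ext i
  fin_cases i <;> simp

theorem frontV_eq_zero_iff {ρ : ℝ → ℝ} {q : ℝ × ℝ} :
    frontV ρ q = 0 ↔ singularFunction ρ q = 0 := by
  refine ⟨fun h => ?_, frontV_eq_zero⟩
  have h1 : singularFunction ρ q * Real.sin (q.2 + q.1) = 0 := by
    simpa [frontV] using congrArg (fun x : ExtSpace => x 1) h
  have h2 : singularFunction ρ q * Real.cos (q.2 + q.1) = 0 := by
    simpa [frontV] using congrArg (fun x : ExtSpace => x 2) h
  linear_combination Real.sin (q.2 + q.1) * h1 + Real.cos (q.2 + q.1) * h2 -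
    singularFunction ρ q * Real.sin_sq_add_cos_sq (q.2 + q.1)

/-- The first coordinates of `F_α` and `F_θ` are `1` and `0`, so a kernel vector is a multiple of
`∂_θ`, and a nonzero one exists only where `F_θ = 0`. -/
theorem isSingular_front_iff (hp : IsSupportFunction m p) (q : ℝ × ℝ) :
    IsSingular (front p) q ↔ singularFunction (rho p) q = 0 := by
  rw [IsSingular, ← frontV_eq_zero_iff, not_iff_comm, injective_iff_map_eq_zero]
  constructor
  · intro h v hv
    rw [fderiv_front_apply hp] at hv
    have h1 : v.1 = 0 := by
      simpa [frontU, frontV] using congrArg (fun x : ExtSpace => x 0) hv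
    rw [h1, zero_smul, zero_add, smul_eq_zero] at hv
    exact Prod.ext h1 (hv.resolve_right h)
  · intro h h0
    rw [← fderiv_front_snd hp] at h0
    simpa using h _ h0

theorem fderiv_singularFunction {ρ : ℝ → ℝ} (hρ : ContDiff ℝ ∞ ρ) (q v : ℝ × ℝ) :
    fderiv ℝ (singularFunction ρ) q v =
      v.1 * (-(ρ q.2 * Real.sin q.1) + deriv ρ q.2 * Real.cos q.1) +
      v.2 * (deriv ρ q.2 * Real.cos q.1 + deriv (deriv ρ) q.2 * Real.sin q.1) := by
  rw [fderiv_apply_prod,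
    fderiv_apply_fst_eq (differentiable_singularFunction hρ q) (hasDerivAt_singularFunction_fst q),
    fderiv_apply_snd_eq (differentiable_singularFunction hρ q)
      (hasDerivAt_singularFunction_snd hρ q)]
  rfl

theorem fderiv_areaDensity_front (hp : IsSupportFunction m p) {q : ℝ × ℝ}
    (hq : singularFunction (rho p) q = 0) (v : ℝ × ℝ) :
    fderiv ℝ (areaDensity (front p) (frontNormal p)) q v =
      normalLength (rho p) q * fderiv ℝ (singularFunction (rho p)) q v := by
  rw [areaDensity_front hp, fderiv_fun_mul (differentiable_singularFunction hp.contDiff_rho q)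
    (differentiable_normalLength hp.contDiff_rho q), hq]
  simp

/-- At a singular point of the front, `A₂` means that the singular function has a non-zero
derivative in the null direction. -/
theorem isA2Point_front_iff (hp : IsSupportFunction m p) (q : ℝ × ℝ) :
    IsA2Point (front p) (frontNormal p) q ↔ singularFunction (rho p) q = 0 ∧
      deriv (rho p) q.2 * Real.cos q.1 + deriv (deriv (rho p)) q.2 * Real.sin q.1 ≠ 0 := by
  rw [IsA2Point, isSingular_front_iff hp]
  refine and_congr_right fun hq => ?_
  have hw := (normalLength_pos (rho p) q).ne'
  have key : ∀ η : ℝ × ℝ, fderiv ℝ (front p) q η = 0 → η.1 = 0 := by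
    intro η h
    rw [fderiv_front_apply hp] at h
    simpa [frontU, frontV] using congrArg (fun x : ExtSpace => x 0) h
  constructor
  · rintro ⟨-, h⟩
    have := h (0, 1) (by simp) (by rw [fderiv_front_snd hp, frontV_eq_zero hq])
    rw [fderiv_areaDensity_front hp hq, fderiv_singularFunction hp.contDiff_rho] at this
    simpa [hw] using this
  · intro h
    have h' : ∀ η : ℝ × ℝ, η ≠ 0 → fderiv ℝ (front p) q η = 0 →
        fderiv ℝ (areaDensity (front p) (frontNormal p)) q η ≠ 0 := by
      intro η h0 h1
      have h2 := key η h1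
      rw [fderiv_areaDensity_front hp hq, fderiv_singularFunction hp.contDiff_rho, h2, zero_mul,
        zero_add]
      exact mul_ne_zero hw (mul_ne_zero (fun h3 => h0 (Prod.ext h2 h3)) h)
    refine ⟨fun h0 => ?_, h'⟩
    exact h' (0, 1) (by simp) (by rw [fderiv_front_snd hp, frontV_eq_zero hq]) (by rw [h0]; rfl)

end FrontGeometry


/-! ### Integration over the time -/

/-- The angle is the argument of `-y + i x`. A negative argument is turned by `π`, which the sign of
`R` absorbs, so a half circle suffices. -/
theorem exists_polar_angle {x y : ℝ} (h : 0 < x ^ 2 + y ^ 2) :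
    ∃ a ∈ Icc 0 Real.pi, ∃ R : ℝ, R ≠ 0 ∧ x = R * Real.sin a ∧ y = -(R * Real.cos a) := by
  set z : ℂ := ⟨-y, x⟩ with hz
  have hz0 : z ≠ 0 := by
    rintro h0
    have h1 := congrArg Complex.re h0
    have h2 := congrArg Complex.im h0
    simp [hz] at h1 h2
    simp [h1, h2] at h
  have hc : ‖z‖ * Real.cos z.arg = -y := Complex.norm_mul_cos_arg z
  have hs : ‖z‖ * Real.sin z.arg = x := Complex.norm_mul_sin_arg z
  rcases lt_or_ge z.arg 0 with h0 | h0
  · refine ⟨z.arg + Real.pi, ⟨by linarith [Complex.neg_pi_lt_arg z], by linarith⟩, -‖z‖,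
      by simpa using hz0, ?_, ?_⟩
    · rw [Real.sin_add_pi]; linarith
    · rw [Real.cos_add_pi]; linarith
  · exact ⟨z.arg, ⟨h0, Complex.arg_le_pi z⟩, ‖z‖, by simpa using hz0, hs.symm, by linarith⟩

/-- The two summands integrate the cosine and the sine term separately; for the sine term one reads
`1 + x² sin² α` as `(1 + x²) - x² cos² α`. -/
theorem hasDerivAt_curvature_primitive (x y α : ℝ) :
    HasDerivAt (fun α => x * Real.sin α / Real.sqrt (1 + x ^ 2 * Real.sin α ^ 2) +
        y * Real.cos α / (Real.sqrt (1 + x ^ 2 * Real.sin α ^ 2) * (1 + x ^ 2)))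
      ((x * Real.cos α - y * Real.sin α) / Real.sqrt (1 + x ^ 2 * Real.sin α ^ 2) ^ 3) α := by
  have hw : 0 < Real.sqrt (1 + x ^ 2 * Real.sin α ^ 2) := Real.sqrt_pos.2 (by positivity)
  have hw2 : Real.sqrt (1 + x ^ 2 * Real.sin α ^ 2) ^ 2 = 1 + x ^ 2 * Real.sin α ^ 2 :=
    Real.sq_sqrt (by positivity)
  have hx : (0 : ℝ) < 1 + x ^ 2 := by positivity
  have hs := Real.hasDerivAt_sin α
  have hc := Real.hasDerivAt_cos α
  have hd := (((hs.pow 2).const_mul (x ^ 2)).const_add 1).sqrt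
    (show 1 + x ^ 2 * Real.sin α ^ 2 ≠ 0 by positivity)
  convert! ((hs.const_mul x).div hd hw.ne').add ((hc.const_mul y).div (hd.mul_const (1 + x ^ 2))
    (mul_pos hw hx).ne') using 1
  simp only [Pi.pow_apply, Nat.cast_ofNat, Nat.add_one_sub_one, pow_one]
  set w := Real.sqrt (1 + x ^ 2 * Real.sin α ^ 2)
  have h2 := Real.sin_sq_add_cos_sq α
  field_simp
  have e : x ^ 2 * Real.cos α ^ 2 = 1 + x ^ 2 - w ^ 2 := by rw [hw2]; linear_combination x ^ 2 * h2
  have e' : x ^ 2 * Real.sin α ^ 2 = w ^ 2 - 1 := by rw [hw2]; ring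
  linear_combination ((1 + x ^ 2) * x * Real.cos α) * e' + (y * Real.sin α) * e

theorem continuous_curvature_integrand (x y : ℝ) :
    Continuous fun α =>
      (x * Real.cos α - y * Real.sin α) / Real.sqrt (1 + x ^ 2 * Real.sin α ^ 2) ^ 3 := by
  refine Continuous.div (by fun_prop) (by fun_prop) fun α => ?_
  have : 0 < Real.sqrt (1 + x ^ 2 * Real.sin α ^ 2) := Real.sqrt_pos.2 (by positivity)
  positivity

/-- In the polar form of `(x, y)` the argument of the sign is `R sin (a - α)`, which changes sign
only at `a`. Splitting there makes the sign constant on each piece; the pieces are treated as open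
intervals because the sign takes another value at `a`. -/
theorem integral_sign_mul_curvature {x y : ℝ} (h : 0 < x ^ 2 + y ^ 2) :
    ∫ α in (0 : ℝ)..Real.pi, (SignType.sign (x * Real.cos α + y * Real.sin α) : ℝ) *
        ((x * Real.cos α - y * Real.sin α) / Real.sqrt (1 + x ^ 2 * Real.sin α ^ 2) ^ 3) =
      2 / Real.sqrt (x ^ 2 + y ^ 2 + x ^ 4) * (x ^ 2 - y ^ 2 / (1 + x ^ 2)) := by
  obtain ⟨a, ⟨ha0, haπ⟩, R, hR, hx, hy⟩ := exists_polar_angle h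
  have hc : ∀ α, x * Real.cos α + y * Real.sin α = R * Real.sin (a - α) := by
    intro α
    rw [Real.sin_sub, hx, hy]
    ring
  have hFTC : ∀ u v, ∫ α in u..v,
      (x * Real.cos α - y * Real.sin α) / Real.sqrt (1 + x ^ 2 * Real.sin α ^ 2) ^ 3 = _ :=
    fun u v => intervalIntegral.integral_eq_sub_of_hasDerivAt
      (fun α _ => hasDerivAt_curvature_primitive x y α)
      ((continuous_curvature_integrand x y).intervalIntegrable u v)
  have h1 : EqOn (fun α => (SignType.sign (x * Real.cos α + y * Real.sin α) : ℝ) *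
        ((x * Real.cos α - y * Real.sin α) / Real.sqrt (1 + x ^ 2 * Real.sin α ^ 2) ^ 3))
      (fun α => (SignType.sign R : ℝ) *
        ((x * Real.cos α - y * Real.sin α) / Real.sqrt (1 + x ^ 2 * Real.sin α ^ 2) ^ 3))
      (Ioo 0 a) := by
    intro α hα
    have : 0 < Real.sin (a - α) :=
      Real.sin_pos_of_pos_of_lt_pi (by linarith [hα.2]) (by linarith [hα.1])
    simp only [hc, sign_mul, sign_pos this, mul_one]
  have h2 : EqOn (fun α => (SignType.sign (x * Real.cos α + y * Real.sin α) : ℝ) *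
        ((x * Real.cos α - y * Real.sin α) / Real.sqrt (1 + x ^ 2 * Real.sin α ^ 2) ^ 3))
      (fun α => (-(SignType.sign R : ℝ)) *
        ((x * Real.cos α - y * Real.sin α) / Real.sqrt (1 + x ^ 2 * Real.sin α ^ 2) ^ 3))
      (Ioo a Real.pi) := by
    intro α hα
    have : Real.sin (a - α) < 0 :=
      Real.sin_neg_of_neg_of_neg_pi_lt (by linarith [hα.1]) (by linarith [hα.2])
    simp [hc, sign_mul, sign_neg this]
  have i1 : IntervalIntegrable (fun α => (SignType.sign (x * Real.cos α + y * Real.sin α) : ℝ) *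
        ((x * Real.cos α - y * Real.sin α) / Real.sqrt (1 + x ^ 2 * Real.sin α ^ 2) ^ 3))
      volume 0 a := by
    rw [intervalIntegrable_iff_integrableOn_Ioo_of_le ha0,
      integrableOn_congr_fun h1 measurableSet_Ioo,
      ← intervalIntegrable_iff_integrableOn_Ioo_of_le ha0]
    exact ((continuous_curvature_integrand x y).const_mul _).intervalIntegrable 0 a
  have i2 : IntervalIntegrable (fun α => (SignType.sign (x * Real.cos α + y * Real.sin α) : ℝ) *
        ((x * Real.cos α - y * Real.sin α) / Real.sqrt (1 + x ^ 2 * Real.sin α ^ 2) ^ 3))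
      volume a Real.pi := by
    rw [intervalIntegrable_iff_integrableOn_Ioo_of_le haπ,
      integrableOn_congr_fun h2 measurableSet_Ioo,
      ← intervalIntegrable_iff_integrableOn_Ioo_of_le haπ]
    exact ((continuous_curvature_integrand x y).const_mul _).intervalIntegrable a _
  rw [← intervalIntegral.integral_add_adjacent_intervals i1 i2,
    intervalIntegral.integral_of_le ha0, integral_Ioc_eq_integral_Ioo,
    setIntegral_congr_fun measurableSet_Ioo h1, ← integral_Ioc_eq_integral_Ioo,
    ← intervalIntegral.integral_of_le ha0,
    intervalIntegral.integral_of_le haπ, integral_Ioc_eq_integral_Ioo,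
    setIntegral_congr_fun measurableSet_Ioo h2, ← integral_Ioc_eq_integral_Ioo,
    ← intervalIntegral.integral_of_le haπ, intervalIntegral.integral_const_mul,
    intervalIntegral.integral_const_mul, hFTC, hFTC]
  have hw : 0 < Real.sqrt (1 + x ^ 2 * Real.sin a ^ 2) := Real.sqrt_pos.2 (by positivity)
  -- The radical in the result is `|R|` times the value of `w` at the angle `a`, where both pieces
  -- meet.
  have hS : Real.sqrt (x ^ 2 + y ^ 2 + x ^ 4) = |R| * Real.sqrt (1 + x ^ 2 * Real.sin a ^ 2) := by
    rw [← Real.sqrt_sq_eq_abs, ← Real.sqrt_mul (sq_nonneg R)]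
    congr 1
    rw [hx, hy]
    linear_combination R ^ 2 * Real.sin_sq_add_cos_sq a
  rw [hS]
  simp only [Real.sin_zero, Real.sin_pi, Real.cos_zero, Real.cos_pi]
  set w := Real.sqrt (1 + x ^ 2 * Real.sin a ^ 2)
  have hsR : (SignType.sign R : ℝ) = R / |R| := by
    rcases lt_or_gt_of_ne hR with h' | h'
    · rw [sign_neg h', abs_of_neg h']; simp [hR]
    · rw [sign_pos h', abs_of_pos h']; simp [hR]
  have hRa : |R| ≠ 0 := abs_ne_zero.2 hR
  have hx1 : (1 : ℝ) + x ^ 2 ≠ 0 := by positivity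
  have e1 : R * Real.sin a = x := hx.symm
  have e2 : R * Real.cos a = -y := by linarith
  rw [hsR]
  norm_num
  field_simp
  linear_combination (2 * x * (1 + x ^ 2)) * e1 + (2 * y) * e2


theorem sign_eq_ite (x : ℝ) :
    (SignType.sign x : ℝ) = if 0 < x then 1 else if x < 0 then -1 else 0 := by
  rw [sign_apply]
  split_ifs <;> simp

/-! ### The total Gaussian curvature -/

section TotalCurvature

open FrontGeometry

variable {m : ℕ} {p : ℝ → ℝ}

theorem integrableOn_curvatureDensity_front (hp : IsSupportFunction m p) :
    IntegrableOn (curvatureDensity (front p) (frontNormal p)) (fundamentalDomain (period m)) := by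
  have h0 := hp.contDiff_rho.continuous
  have h1 := (contDiff_deriv_of_contDiff hp.contDiff_rho).continuous
  have hc : Continuous (singularFunction (rho p)) :=
    (differentiable_singularFunction hp.contDiff_rho).continuous
  have hw : Continuous (normalLength (rho p)) :=
    (differentiable_normalLength hp.contDiff_rho).continuous
  have hk : Continuous fun q : ℝ × ℝ =>
      (rho p q.2 * Real.cos q.1 - deriv (rho p) q.2 * Real.sin q.1) /
        normalLength (rho p) q ^ 3 := by
    refine Continuous.div (by fun_prop) (by fun_prop) fun q => ?_
    have := normalLength_pos (rho p) q
    positivity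
  have hK : IntegrableOn (fun q : ℝ × ℝ =>
      (rho p q.2 * Real.cos q.1 - deriv (rho p) q.2 * Real.sin q.1) /
        normalLength (rho p) q ^ 3) (fundamentalDomain (period m)) :=
    (hk.continuousOn.integrableOn_compact
      ((isCompact_Icc (a := (0 : ℝ)) (b := Real.pi)).prod
        (isCompact_Icc (a := (0 : ℝ)) (b := period m)))).mono_set
      (prod_mono Subset.rfl Ico_subset_Icc_self)
  rw [show curvatureDensity (front p) (frontNormal p) = _ from funext (curvatureDensity_front hp)]
  have hs : Measurable fun q : ℝ × ℝ => (SignType.sign (singularFunction (rho p) q) : ℝ) := by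
    simp only [sign_eq_ite]
    exact Measurable.ite (measurableSet_lt measurable_const hc.measurable) measurable_const
      (Measurable.ite (measurableSet_lt hc.measurable measurable_const) measurable_const
        measurable_const)
  refine Integrable.mono hK (hs.mul hk.measurable).aestronglyMeasurable
    (Eventually.of_forall fun q => ?_)
  rw [norm_mul]
  refine mul_le_of_le_one_left (norm_nonneg _) ?_
  rw [sign_eq_ite]
  split_ifs <;> simp

theorem integral_curvatureDensity_front (hm : 0 < m) (hp : IsSupportFunction m p)
    (hreg : ∀ θ, 0 < rho p θ ^ 2 + deriv (rho p) θ ^ 2) :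
    ∫ q in fundamentalDomain (period m), curvatureDensity (front p) (frontNormal p) q =
      ∫ θ in (0 : ℝ)..period m,
        2 / Real.sqrt (rho p θ ^ 2 + deriv (rho p) θ ^ 2 + rho p θ ^ 4) *
          (rho p θ ^ 2 - deriv (rho p) θ ^ 2 / (1 + rho p θ ^ 2)) := by
  have hint := integrableOn_curvatureDensity_front hp
  rw [fundamentalDomain, Measure.volume_eq_prod] at hint ⊢
  -- Coordinates are exchanged so that Fubini integrates over the time `α` first.
  have hswap : IntegrableOn (fun q : ℝ × ℝ => curvatureDensity (front p) (frontNormal p) q.swap)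
    (Ico 0 (period m) ×ˢ Icc 0 Real.pi) (volume.prod volume) := hint.swap
  rw [← setIntegral_prod_swap, setIntegral_prod _ hswap,
    intervalIntegral.integral_of_le (period_pos hm).le, ← integral_Ico_eq_integral_Ioc]
  refine setIntegral_congr_fun measurableSet_Ico fun θ _ => ?_
  rw [← integral_sign_mul_curvature (hreg θ), intervalIntegral.integral_of_le Real.pi_pos.le,
    ← integral_Icc_eq_integral_Ioc]
  refine setIntegral_congr_fun measurableSet_Icc fun α _ => ?_
  exact curvatureDensity_front hp (α, θ)

end TotalCurvature

/-! ### The density of the singular curvature -/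

/-- Up to the sign, the density of the singular curvature measure with respect to the parameter of
the hedgehog. -/
noncomputable def singularDensity (ρ : ℝ → ℝ) (θ : ℝ) : ℝ :=
  (deriv ρ θ ^ 2 / (1 + ρ θ ^ 2) + ρ θ ^ 2 *
      (1 + 2 * ((ρ θ * deriv (deriv ρ) θ - deriv ρ θ ^ 2) / (ρ θ ^ 2 + deriv ρ θ ^ 2)))) /
    Real.sqrt (ρ θ ^ 2 + deriv ρ θ ^ 2 + ρ θ ^ 4)

section Density

variable {ρ : ℝ → ℝ}

theorem continuous_singularDensity (hρ : ContDiff ℝ ∞ ρ)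
    (hreg : ∀ θ, 0 < ρ θ ^ 2 + deriv ρ θ ^ 2) : Continuous (singularDensity ρ) := by
  have h0 := hρ.continuous
  have h1 := (contDiff_deriv_of_contDiff hρ).continuous
  have h2 := (contDiff_deriv_of_contDiff (contDiff_deriv_of_contDiff hρ)).continuous
  have h3 : Continuous fun θ => deriv ρ θ ^ 2 / (1 + ρ θ ^ 2) :=
    Continuous.div (by fun_prop) (by fun_prop) fun θ => by positivity
  have h4 : Continuous fun θ =>
      (ρ θ * deriv (deriv ρ) θ - deriv ρ θ ^ 2) / (ρ θ ^ 2 + deriv ρ θ ^ 2) :=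
    Continuous.div (by fun_prop) (by fun_prop) fun θ => (hreg θ).ne'
  refine Continuous.div (by fun_prop) (by fun_prop) fun θ => ?_
  have : 0 < ρ θ ^ 2 + deriv ρ θ ^ 2 + ρ θ ^ 4 := by have := hreg θ; positivity
  exact (Real.sqrt_pos.2 this).ne'

theorem periodic_singularDensity {T : ℝ} (hT : Function.Periodic ρ T) :
    Function.Periodic (singularDensity ρ) T := by
  intro θ
  simp only [singularDensity, hT θ, periodic_deriv hT θ, periodic_deriv (periodic_deriv hT) θ]

/-- This derivative is the correction term between the Gaussian curvature integrand and the singular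
one. The algebra closes because `1 + (ρ ρ' / S)²` factors as `(1 + ρ²)(ρ² + ρ'²) / S²`, where `S` is
the radical. -/
theorem hasDerivAt_arctan_primitive (hρ : ContDiff ℝ ∞ ρ)
    (hreg : ∀ θ, 0 < ρ θ ^ 2 + deriv ρ θ ^ 2) (θ : ℝ) :
    HasDerivAt (fun θ => Real.arctan (ρ θ * deriv ρ θ /
        Real.sqrt (ρ θ ^ 2 + deriv ρ θ ^ 2 + ρ θ ^ 4)))
      ((deriv ρ θ ^ 2 / (1 + ρ θ ^ 2) + ρ θ ^ 2 *
        ((ρ θ * deriv (deriv ρ) θ - deriv ρ θ ^ 2) / (ρ θ ^ 2 + deriv ρ θ ^ 2))) /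
        Real.sqrt (ρ θ ^ 2 + deriv ρ θ ^ 2 + ρ θ ^ 4)) θ := by
  have h0 := hasDerivAt_of_contDiff hρ θ
  have h1 := hasDerivAt_of_contDiff (contDiff_deriv_of_contDiff hρ) θ
  have hr := hreg θ
  have hS : 0 < ρ θ ^ 2 + deriv ρ θ ^ 2 + ρ θ ^ 4 := by positivity
  have hd := ((h0.mul h1).div (((h0.pow 2).add (h1.pow 2)).add (h0.pow 4) |>.sqrt hS.ne')
    (Real.sqrt_pos.2 hS).ne').arctan
  convert! hd using 1
  simp only [Pi.mul_apply, Pi.pow_apply, Pi.add_apply, Pi.div_apply]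
  have hS2 := Real.sq_sqrt hS.le
  have hS0 := Real.sqrt_pos.2 hS
  set S := Real.sqrt (ρ θ ^ 2 + deriv ρ θ ^ 2 + ρ θ ^ 4)
  set x := ρ θ
  set y := deriv ρ θ
  set z := deriv (deriv ρ) θ
  have hx : 0 < 1 + x ^ 2 := by positivity
  have e : 1 + (x * y / S) ^ 2 = (1 + x ^ 2) * (x ^ 2 + y ^ 2) / S ^ 2 := by
    field_simp
    rw [hS2]
    ring
  rw [e]
  push_cast
  field_simp
  rw [hS2]
  ring

theorem integral_curvature_eq_integral_singularDensity (hρ : ContDiff ℝ ∞ ρ)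
    (hreg : ∀ θ, 0 < ρ θ ^ 2 + deriv ρ θ ^ 2) {T : ℝ} (hT : Function.Periodic ρ T) :
    ∫ θ in (0 : ℝ)..T, 2 / Real.sqrt (ρ θ ^ 2 + deriv ρ θ ^ 2 + ρ θ ^ 4) *
          (ρ θ ^ 2 - deriv ρ θ ^ 2 / (1 + ρ θ ^ 2)) =
      2 * ∫ θ in (0 : ℝ)..T, singularDensity ρ θ := by
  have hc := continuous_singularDensity hρ hreg
  have h0 := hρ.continuous
  have h1 := (contDiff_deriv_of_contDiff hρ).continuous
  have hS : ∀ θ, Real.sqrt (ρ θ ^ 2 + deriv ρ θ ^ 2 + ρ θ ^ 4) ≠ 0 := fun θ => by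
    have := hreg θ
    exact (Real.sqrt_pos.2 (by positivity)).ne'
  have hJ : Continuous fun θ => 2 / Real.sqrt (ρ θ ^ 2 + deriv ρ θ ^ 2 + ρ θ ^ 4) *
      (ρ θ ^ 2 - deriv ρ θ ^ 2 / (1 + ρ θ ^ 2)) := by
    have h3 : Continuous fun θ => deriv ρ θ ^ 2 / (1 + ρ θ ^ 2) :=
      Continuous.div (by fun_prop) (by fun_prop) fun θ => by positivity
    have h4 : Continuous fun θ => 2 / Real.sqrt (ρ θ ^ 2 + deriv ρ θ ^ 2 + ρ θ ^ 4) :=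
      Continuous.div (by fun_prop) (by fun_prop) hS
    fun_prop
  have hFTC : ∫ θ in (0 : ℝ)..T, (2 * singularDensity ρ θ -
      2 / Real.sqrt (ρ θ ^ 2 + deriv ρ θ ^ 2 + ρ θ ^ 4) *
        (ρ θ ^ 2 - deriv ρ θ ^ 2 / (1 + ρ θ ^ 2))) = _ :=
    intervalIntegral.integral_eq_sub_of_hasDerivAt
      (fun θ _ => by
        convert! (hasDerivAt_arctan_primitive hρ hreg θ).const_mul 4 using 1
        have := hS θ
        have := (hreg θ).ne'
        have hx : 1 + ρ θ ^ 2 ≠ 0 := by positivity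
        rw [singularDensity]
        field_simp
        ring) (((hc.const_mul 2).sub hJ).intervalIntegrable _ _)
  -- By periodicity the arctangent takes equal values at both ends, so the integral of the
  -- difference vanishes.
  rw [← zero_add T, hT 0, periodic_deriv hT 0, sub_self, zero_add,
    intervalIntegral.integral_sub ((hc.const_mul 2).intervalIntegrable _ _)
      (hJ.intervalIntegrable _ _), intervalIntegral.integral_const_mul] at hFTC
  linarith

end Density


/-! ### Singular arcs of the front -/

section Arc

open FrontGeometry

/-- Multiples of `x` and `z` drop out of the determinant. In the geodesic curvature this discards
both the derivative of the normalizing factor and the projection along `ν`. -/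
theorem det3_frame (a b c d e : ℝ) (x y z : ExtSpace) :
    det3 (a • x) (b • ((c • y + d • x) - e • z)) z = a * b * c * det3 x y z := by
  simp only [det3, Matrix.det_fin_three]
  simp
  ring

theorem norm_frontU (ρ : ℝ → ℝ) (q : ℝ × ℝ) : ‖frontU ρ q‖ = Real.sqrt (1 + ρ q.2 ^ 2) := by
  rw [norm_eq_sqrt_real_inner, inner_extSpace, frontU]
  congr 1
  simp
  linear_combination (ρ q.2 ^ 2) * Real.sin_sq_add_cos_sq (q.2 + 2 * q.1)

theorem velocity_front {m : ℕ} {p : ℝ → ℝ} (hp : IsSupportFunction m p) {σ : ℝ → ℝ × ℝ} {t : ℝ}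
    (h : singularFunction (rho p) (σ t) = 0) :
    velocity (front p) σ t = (deriv σ t).1 • frontU (rho p) (σ t) := by
  rw [velocity, fderiv_front_apply hp, frontV_eq_zero h, smul_zero, add_zero]

theorem speed_front {m : ℕ} {p : ℝ → ℝ} (hp : IsSupportFunction m p) {σ : ℝ → ℝ × ℝ} {t : ℝ}
    (h : singularFunction (rho p) (σ t) = 0) :
    speed (front p) σ t = |(deriv σ t).1| * Real.sqrt (1 + rho p (σ t).2 ^ 2) := by
  rw [speed, velocity_front hp h, norm_smul, norm_frontU, Real.norm_eq_abs]

theorem det3_frontU_deriv_frontNormal (p : ℝ → ℝ) (hρ : ContDiff ℝ ∞ (rho p)) (q v : ℝ × ℝ) :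
    det3 (frontU (rho p) q) (fderiv ℝ (frontU (rho p)) q v) (frontNormal p q) =
      (deriv (rho p) q.2 * v.2 * Real.cos q.1 -
        rho p q.2 * (v.2 + 2 * v.1) * Real.sin q.1 * (1 + rho p q.2 ^ 2)) /
        normalLength (rho p) q := by
  have hw := normalLength_pos (rho p) q
  rw [fderiv_apply_prod, show fderiv ℝ (frontU (rho p)) q (1, 0) = _ from partialU_frontU hρ q,
    show fderiv ℝ (frontU (rho p)) q (0, 1) = _ from partialV_frontU hρ q, frontNormal_eq, det3,
    Matrix.det_fin_three, frontU]
  have h1 := Real.sin_sq_add_cos_sq (q.2 + q.1)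
  have h2 := Real.sin_sq_add_cos_sq (q.2 + 2 * q.1)
  have hs : Real.sin q.1 = Real.sin (q.2 + 2 * q.1) * Real.cos (q.2 + q.1) -
      Real.cos (q.2 + 2 * q.1) * Real.sin (q.2 + q.1) := by
    rw [← Real.sin_sub]; congr 1; ring
  have hc : Real.cos q.1 = Real.cos (q.2 + 2 * q.1) * Real.cos (q.2 + q.1) +
      Real.sin (q.2 + 2 * q.1) * Real.sin (q.2 + q.1) := by
    rw [← Real.cos_sub]; congr 1; ring
  simp
  field_simp
  rw [hc]
  linear_combination (2 * v.1 * rho p q.2 + v.2 * rho p q.2) * hs -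
    (rho p q.2 ^ 3 * Real.sin q.1 * (2 * v.1 + v.2)) * h2

variable {m : ℕ} {p : ℝ → ℝ} {σ : ℝ → ℝ × ℝ} {u v : ℝ}

theorem geodesicCurvature_mul_speed (hp : IsSupportFunction m p)
    (hσ : ContDiffOn ℝ 2 σ (Ioo u v))
    (hsing : ∀ t ∈ Ioo u v, singularFunction (rho p) (σ t) = 0) {t : ℝ} (ht : t ∈ Ioo u v)
    (hd : (deriv σ t).1 ≠ 0) :
    geodesicCurvature (front p) (frontNormal p) σ t * speed (front p) σ t =
      (deriv (rho p) (σ t).2 * (deriv σ t).2 * Real.cos (σ t).1 / (1 + rho p (σ t).2 ^ 2) -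
        rho p (σ t).2 * ((deriv σ t).2 + 2 * (deriv σ t).1) * Real.sin (σ t).1) /
        normalLength (rho p) (σ t) := by
  have hnhds : Ioo u v ∈ 𝓝 t := isOpen_Ioo.mem_nhds ht
  have hσt : HasDerivAt σ (deriv σ t) t :=
    ((hσ.contDiffAt hnhds).differentiableAt (by simp)).hasDerivAt
  have hcont : ContinuousAt (fun s => (deriv σ s).1) t :=
    (((hσ.continuousOn_deriv_of_isOpen isOpen_Ioo (by simp)).continuousAt hnhds)).fst
  have hspeed := speed_front hp (hsing t ht)
  have hone : ∀ θ, 0 < 1 + rho p θ ^ 2 := fun θ => by positivity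
  have hsq : 0 < Real.sqrt (1 + rho p (σ t).2 ^ 2) := Real.sqrt_pos.2 (hone _)
  have hspos : 0 < speed (front p) σ t := by
    rw [hspeed]
    exact mul_pos (abs_pos.2 hd) hsq
  -- The velocity is `α' F_α`. As `α'` is continuous and nonzero at `t`, the unit tangent is locally
  -- `F_α / |F_α|` up to a constant sign `ε`. The sign enters the determinant twice and disappears
  -- through `ε² = 1`.
  obtain ⟨ε, hε, hev⟩ : ∃ ε : ℝ, ε ^ 2 = 1 ∧ unitTangent (front p) σ =ᶠ[𝓝 t] fun s =>
      ε • ((Real.sqrt (1 + rho p (σ s).2 ^ 2))⁻¹ • frontU (rho p) (σ s)) := by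
    rcases lt_or_gt_of_ne hd with h | h
    · refine ⟨-1, by norm_num, ?_⟩
      filter_upwards [hnhds, hcont.eventually_lt_const h] with s hs hs'
      have := Real.sqrt_pos.2 (hone (σ s).2)
      rw [unitTangent, speed_front hp (hsing s hs), velocity_front hp (hsing s hs), smul_smul,
        smul_smul, abs_of_neg hs']
      congr 1
      have := hs'.ne
      field_simp
    · refine ⟨1, by norm_num, ?_⟩
      filter_upwards [hnhds, hcont.eventually_const_lt h] with s hs hs'
      have := Real.sqrt_pos.2 (hone (σ s).2)
      rw [unitTangent, speed_front hp (hsing s hs), velocity_front hp (hsing s hs), smul_smul,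
        smul_smul, abs_of_pos hs']
      congr 1
      have := hs'.ne'
      field_simp
  have hb : DifferentiableAt ℝ (fun s => (σ s).2) t := hσt.differentiableAt.snd
  have hk : DifferentiableAt ℝ (fun s => (Real.sqrt (1 + rho p (σ s).2 ^ 2))⁻¹) t := by
    have h1 : DifferentiableAt ℝ (fun s => rho p (σ s).2) t :=
      (hp.contDiff_rho.differentiable (by simp) _).comp t hb
    exact ((h1.pow 2).const_add 1 |>.sqrt (hone _).ne').inv hsq.ne'
  have hV : HasDerivAt (fun s => frontU (rho p) (σ s))
      (fderiv ℝ (frontU (rho p)) (σ t) (deriv σ t)) t :=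
    (differentiable_frontU hp.contDiff_rho (σ t)).hasFDerivAt.comp_hasDerivAt t hσt
  have hderiv := hev.deriv_eq.trans ((hk.hasDerivAt.smul hV).const_smul ε).deriv
  have hself : unitTangent (front p) σ t =
      ε • ((Real.sqrt (1 + rho p (σ t).2 ^ 2))⁻¹ • frontU (rho p) (σ t)) := hev.self_of_nhds
  rw [geodesicCurvature, covDeriv, hderiv, hself, smul_add ε, smul_smul ε, smul_smul ε,
    smul_smul ε]
  rw [det3_frame, det3_frontU_deriv_frontNormal p hp.contDiff_rho]
  have hw := normalLength_pos (rho p) (σ t)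
  have hs2 := Real.sq_sqrt (hone (σ t).2).le
  have h1 := hone (σ t).2
  set n := Real.sqrt (1 + rho p (σ t).2 ^ 2)
  rw [← hs2]
  field_simp
  rw [hε]
  ring

end Arc


/-! ### The singular curvature measure along an arc -/

section ArcDensity

open FrontGeometry

variable {m : ℕ} {p : ℝ → ℝ} {σ : ℝ → ℝ × ℝ} {u v : ℝ}

/-- The singular function and its `α`-derivative are the coordinates of `(ρ, ρ')` in a frame rotated
by `α`; when the first vanishes, the second carries the whole norm. -/
theorem sq_singularFunction_deriv {ρ : ℝ → ℝ} {q : ℝ × ℝ} (h : singularFunction ρ q = 0) :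
    (-(ρ q.2 * Real.sin q.1) + deriv ρ q.2 * Real.cos q.1) ^ 2 = ρ q.2 ^ 2 + deriv ρ q.2 ^ 2 := by
  rw [singularFunction] at h
  linear_combination (ρ q.2 ^ 2 + deriv ρ q.2 ^ 2) * Real.sin_sq_add_cos_sq q.1 -
    (ρ q.2 * Real.cos q.1 + deriv ρ q.2 * Real.sin q.1) * h

theorem singularFunction_deriv_along (hρ : ContDiff ℝ ∞ (rho p)) {t : ℝ} (ht : t ∈ Ioo u v)
    (hσt : DifferentiableAt ℝ σ t)
    (hsing : ∀ t ∈ Ioo u v, singularFunction (rho p) (σ t) = 0) :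
    (deriv σ t).1 * (-(rho p (σ t).2 * Real.sin (σ t).1) +
        deriv (rho p) (σ t).2 * Real.cos (σ t).1) +
      (deriv σ t).2 * (deriv (rho p) (σ t).2 * Real.cos (σ t).1 +
        deriv (deriv (rho p)) (σ t).2 * Real.sin (σ t).1) = 0 := by
  rw [← fderiv_singularFunction hρ]
  have h1 := (differentiable_singularFunction hρ (σ t)).hasFDerivAt.comp_hasDerivAt t
    hσt.hasDerivAt
  have h2 : singularFunction (rho p) ∘ σ =ᶠ[𝓝 t] fun _ => 0 := by
    filter_upwards [isOpen_Ioo.mem_nhds ht] with s hs using hsing s hs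
  exact h1.unique ((hasDerivAt_const t (0 : ℝ)).congr_of_eventuallyEq h2)

/-- Along the arc `c_α α' + c_θ θ' = 0`, with `c_α ≠ 0` by regularity of `(ρ, ρ')` and `c_θ ≠ 0` by
the `A₂` condition. So if one of `α'`, `θ'` vanished, both would. -/
theorem deriv_arc_ne_zero (hρ : ContDiff ℝ ∞ (rho p))
    (hreg : ∀ θ, 0 < rho p θ ^ 2 + deriv (rho p) θ ^ 2) {t : ℝ} (ht : t ∈ Ioo u v)
    (hσt : DifferentiableAt ℝ σ t)
    (hsing : ∀ t ∈ Ioo u v, singularFunction (rho p) (σ t) = 0) (hd : deriv σ t ≠ 0)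
    (hA : deriv (rho p) (σ t).2 * Real.cos (σ t).1 +
        deriv (deriv (rho p)) (σ t).2 * Real.sin (σ t).1 ≠ 0) :
    (deriv σ t).1 ≠ 0 ∧ (deriv σ t).2 ≠ 0 := by
  have h := singularFunction_deriv_along hρ ht hσt hsing
  have h2 := sq_singularFunction_deriv (hsing t ht)
  have h3 : -(rho p (σ t).2 * Real.sin (σ t).1) +
        deriv (rho p) (σ t).2 * Real.cos (σ t).1 ≠ 0 := by
    intro h0
    rw [h0] at h2
    have := hreg (σ t).2
    rw [← h2] at this
    norm_num at this
  constructor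
  · intro h0
    rw [h0, zero_mul, zero_add] at h
    exact hd (Prod.ext h0 ((mul_eq_zero.1 h).resolve_right hA))
  · intro h0
    rw [h0, zero_mul, add_zero] at h
    exact hd (Prod.ext ((mul_eq_zero.1 h).resolve_right h3) h0)

theorem real_sign_eq_div_abs {x : ℝ} (hx : x ≠ 0) : Real.sign x = x / |x| := by
  rcases lt_or_gt_of_ne hx with h | h
  · rw [Real.sign_of_neg h, abs_of_neg h, div_neg, div_self hx]
  · rw [Real.sign_of_pos h, abs_of_pos h, div_self hx]

theorem singularCurvature_mul_speed (hp : IsSupportFunction m p)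
    (hreg : ∀ θ, 0 < rho p θ ^ 2 + deriv (rho p) θ ^ 2)
    (hσ : ContDiffOn ℝ 2 σ (Ioo u v))
    (hsing : ∀ t ∈ Ioo u v, singularFunction (rho p) (σ t) = 0) {t : ℝ} (ht : t ∈ Ioo u v)
    (hd : deriv σ t ≠ 0)
    (hA : deriv (rho p) (σ t).2 * Real.cos (σ t).1 +
        deriv (deriv (rho p)) (σ t).2 * Real.sin (σ t).1 ≠ 0) :
    singularCurvature (front p) (frontNormal p) σ t * speed (front p) σ t =
      -(|(deriv σ t).2| * singularDensity (rho p) (σ t).2) := by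
  have hσt : DifferentiableAt ℝ σ t :=
    (hσ.contDiffAt (isOpen_Ioo.mem_nhds ht)).differentiableAt (by simp)
  obtain ⟨ha, hb⟩ := deriv_arc_ne_zero hp.contDiff_rho hreg ht hσt hsing hd hA
  have hrel := singularFunction_deriv_along hp.contDiff_rho ht hσt hsing
  have hsq := sq_singularFunction_deriv (hsing t ht)
  have hc := hsing t ht
  have hex : ∃ η, IsPositiveNull (front p) σ t η := by
    -- The null direction is `∂_θ`, and this multiple of it makes the orientation determinant equal
    -- to `α'²`.
    refine ⟨(0, (deriv σ t).1), ?_, ?_⟩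
    · rw [fderiv_front_apply hp, frontV_eq_zero hc]
      simp
    · simpa using mul_self_pos.2 ha
  rw [singularCurvature, dif_pos hex, mul_assoc,
    geodesicCurvature_mul_speed hp hσ hsing ht ha]
  obtain ⟨h1, h2⟩ := hex.choose_spec
  set η := hex.choose
  have hη : η.1 = 0 := by
    rw [fderiv_front_apply hp, frontV_eq_zero hc] at h1
    simpa [frontU] using congrArg (fun x : ExtSpace => x 0) h1
  rw [hη, mul_zero, sub_zero] at h2
  rw [fderiv_areaDensity_front hp hc, fderiv_singularFunction hp.contDiff_rho, hη, zero_mul,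
    zero_add]
  have hw := normalLength_pos (rho p) (σ t)
  have hw2 := sq_normalLength (rho p) (σ t)
  have hr := hreg (σ t).2
  rw [singularFunction] at hc
  have htrig := Real.sin_sq_add_cos_sq (σ t).1
  set A := -(rho p (σ t).2 * Real.sin (σ t).1) +
    deriv (rho p) (σ t).2 * Real.cos (σ t).1 with hAdef
  set x := rho p (σ t).2 with hx
  set y := deriv (rho p) (σ t).2 with hy
  set z := deriv (deriv (rho p)) (σ t).2 with hz
  set C := y * Real.cos (σ t).1 + z * Real.sin (σ t).1 with hC
  set a' := (deriv σ t).1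
  set b' := (deriv σ t).2
  -- On the singular set `(ρ, ρ') = A (-sin α, cos α)`, where `A = c_α`. With `C = c_θ` everything
  -- is expressed through `A`, `C` and `θ'`.
  have ex : x = -A * Real.sin (σ t).1 := by
    rw [hAdef]
    linear_combination Real.cos (σ t).1 * hc - x * htrig
  have ey : y = A * Real.cos (σ t).1 := by
    rw [hAdef]
    linear_combination Real.sin (σ t).1 * hc - y * htrig
  have hA0 : A ≠ 0 := by
    intro h0
    rw [h0] at hsq
    norm_num at hsq
    rw [← hsq] at hr
    exact lt_irrefl _ hr
  have hg : x * z - y ^ 2 = -A * C := by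
    rw [hC]
    linear_combination z * ex - y * ey
  have ha' : a' = -C * b' / A := by
    field_simp
    linear_combination hrel
  have hsign : Real.sign (normalLength (rho p) (σ t) * (η.2 * C)) = -(A * b' / |A * b'|) := by
    rw [← real_sign_eq_div_abs (mul_ne_zero hA0 hb), ← Real.sign_neg]
    -- The tangency relation `A α' = -C θ'` turns this product into `α' η₂ A²`, which is positive by
    -- the orientation of `η`.
    have hAb : 0 < (η.2 * C) * (-(A * b')) := by
      have : (η.2 * C) * (-(A * b')) = (a' * η.2) * A ^ 2 := by
        rw [ha']
        field_simp
      rw [this]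
      positivity
    rcases pos_and_pos_or_neg_and_neg_of_mul_pos hAb with ⟨h3, h4⟩ | ⟨h3, h4⟩
    · rw [Real.sign_of_pos (mul_pos hw h3), Real.sign_of_pos h4]
    · rw [Real.sign_of_neg (mul_neg_of_pos_of_neg hw h3), Real.sign_of_neg h4]
  have hS : Real.sqrt (x ^ 2 + y ^ 2 + x ^ 4) = |A| * normalLength (rho p) (σ t) := by
    rw [normalLength, ← Real.sqrt_sq_eq_abs, ← Real.sqrt_mul (sq_nonneg A)]
    congr 1
    rw [mul_add, ← hx]
    linear_combination -hsq + (x ^ 2 * (x - A * Real.sin (σ t).1)) * ex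
  rw [hsign, singularDensity, ← hx, ← hy, ← hz, hS, ← hsq, hg, abs_mul, ha']
  have hAa : |A| ≠ 0 := abs_ne_zero.2 hA0
  have hba : |b'| ≠ 0 := abs_ne_zero.2 hb
  have hb2 : |b'| ^ 2 = b' ^ 2 := sq_abs b'
  have hx1 : 1 + x ^ 2 ≠ 0 := by positivity
  field_simp
  rw [hb2]
  linear_combination (b' ^ 2 * A * y) * ey + (b' ^ 2 * x * (1 + x ^ 2) * (A - 2 * C)) * ex

/-- At a boundary time `α` would have a local extremum along the arc, forcing `α' = 0`. -/
theorem arc_mem_Ioo {t : ℝ} (ht : t ∈ Ioo u v) (hσt : DifferentiableAt ℝ σ t) (hd : (deriv σ t).1 ≠ 0)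
    (hmem : ∀ t ∈ Ioo u v, σ t ∈ singularSet (front p)) : (σ t).1 ∈ Ioo 0 Real.pi := by
  have hnhds := isOpen_Ioo.mem_nhds ht
  have h1 : HasDerivAt (fun s => (σ s).1) (deriv σ t).1 t := hσt.hasDerivAt.fst
  refine ⟨lt_of_le_of_ne (hmem t ht).1.1 fun h => hd ?_,
    lt_of_le_of_ne (hmem t ht).1.2 fun h => hd ?_⟩
  · refine IsLocalMin.hasDerivAt_eq_zero ?_ h1
    filter_upwards [hnhds] with s hs
    rw [← h]
    exact (hmem s hs).1.1
  · refine IsLocalMax.hasDerivAt_eq_zero ?_ h1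
    filter_upwards [hnhds] with s hs
    rw [h]
    exact (hmem s hs).1.2

end ArcDensity

end Hedgehog

/-! ### Arcs covering a circle -/

theorem AddCircle.countable_preimage_coe {T : ℝ} {E : Set (AddCircle T)} (hE : E.Countable) :
    {x : ℝ | (x : AddCircle T) ∈ E}.Countable := by
  have h : {x : ℝ | (x : AddCircle T) ∈ E} ⊆
      ⋃ y ∈ E, range fun n : ℤ => Quotient.out y + n • T := by
    intro x hx
    simp only [mem_iUnion]
    refine ⟨x, hx, ?_⟩
    have h1 : ((x - Quotient.out (x : AddCircle T) : ℝ) : AddCircle T) = 0 := by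
      rw [AddCircle.coe_sub, sub_eq_zero]
      exact (Quotient.out_eq (x : AddCircle T)).symm
    obtain ⟨n, hn⟩ := (AddCircle.coe_eq_zero_iff T).1 h1
    exact ⟨n, by simp only [hn]; ring⟩
  exact (hE.biUnion fun y _ => countable_range _).mono h

theorem isAddFundamentalDomain_iUnion_image {ι : Type*} [Finite ι] {T : ℝ} {lo hi : ι → ℝ}
    {b : ι → ℝ → ℝ} (hcont : ∀ i, ContinuousOn (b i) (Ioo (lo i) (hi i)))
    (hinj : ∀ i j, ∀ t ∈ Ioo (lo i) (hi i), ∀ s ∈ Ioo (lo j) (hi j),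
      (b i t : AddCircle T) = b j s → i = j ∧ t = s)
    {E : Set (AddCircle T)} (hE : E.Finite)
    (hcov : ∀ x : ℝ, (x : AddCircle T) ∉ E →
      ∃ i, ∃ t ∈ Ioo (lo i) (hi i), (b i t : AddCircle T) = x) :
    IsAddFundamentalDomain (AddSubgroup.zmultiples T) (⋃ i, b i '' Ioo (lo i) (hi i)) := by
  refine ⟨?_, ?_, ?_⟩
  · refine (MeasurableSet.iUnion fun i => ?_).nullMeasurableSet
    -- Measurability of each image comes from injectivity and continuity alone; no monotonicity of
    -- `b i` is needed.
    exact measurableSet_Ioo.image_of_continuousOn_injOn (hcont i) fun t ht s hs h =>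
      (hinj i i t ht s hs (by rw [h])).2
  · have h0 : volume {x : ℝ | (x : AddCircle T) ∈ E} = 0 :=
      (AddCircle.countable_preimage_coe hE.countable).measure_zero _
    filter_upwards [compl_mem_ae_iff.2 h0] with x hx
    obtain ⟨i, t, ht, h⟩ := hcov x hx
    have h1 : ((b i t - x : ℝ) : AddCircle T) = 0 := by
      rw [AddCircle.coe_sub, h, sub_self]
    obtain ⟨n, hn⟩ := (AddCircle.coe_eq_zero_iff T).1 h1
    refine ⟨⟨n • T, n, rfl⟩, mem_iUnion.2 ⟨i, t, ht, ?_⟩⟩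
    rw [AddSubgroup.vadd_def, vadd_eq_add]
    simp only [hn]
    ring
  · intro g g' hg
    refine Disjoint.aedisjoint (disjoint_left.2 ?_)
    rintro z ⟨x, hx, rfl⟩ ⟨y, hy, hxy⟩
    obtain ⟨i, t, ht, rfl⟩ := mem_iUnion.1 hx
    obtain ⟨j, s, hs, rfl⟩ := mem_iUnion.1 hy
    simp only [AddSubgroup.vadd_def, vadd_eq_add] at hxy
    have hcoe : ∀ g : AddSubgroup.zmultiples T, ((g : ℝ) : AddCircle T) = 0 := fun g =>
      (QuotientAddGroup.eq_zero_iff _).2 g.2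
    have h1 := congrArg (fun x : ℝ => (x : AddCircle T)) hxy
    simp only [AddCircle.coe_add, hcoe, zero_add] at h1
    obtain ⟨rfl, rfl⟩ := hinj j i s hs t ht h1
    exact hg (Subtype.ext (by linarith))

/-- The integral of a periodic function over a family of arcs that covers the circle once, up to
finitely many points. -/
theorem sum_integral_arcs {ι : Type*} [Fintype ι] {T : ℝ} (hT : 0 < T) {lo hi : ι → ℝ}
    {b b' : ι → ℝ → ℝ} (hderiv : ∀ i, ∀ t ∈ Ioo (lo i) (hi i), HasDerivAt (b i) (b' i t) t)
    (hinj : ∀ i j, ∀ t ∈ Ioo (lo i) (hi i), ∀ s ∈ Ioo (lo j) (hi j),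
      (b i t : AddCircle T) = b j s → i = j ∧ t = s)
    {E : Set (AddCircle T)} (hE : E.Finite)
    (hcov : ∀ x : ℝ, (x : AddCircle T) ∉ E →
      ∃ i, ∃ t ∈ Ioo (lo i) (hi i), (b i t : AddCircle T) = x)
    {f : ℝ → ℝ} (hf : Continuous f) (hper : Function.Periodic f T) :
    (∀ i, IntegrableOn (fun t => |b' i t| * f (b i t)) (Ioo (lo i) (hi i))) ∧
      ∑ i, ∫ t in Ioo (lo i) (hi i), |b' i t| * f (b i t) = ∫ x in (0 : ℝ)..T, f x := by
  have hcont : ∀ i, ContinuousOn (b i) (Ioo (lo i) (hi i)) := fun i t ht =>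
    (hderiv i t ht).continuousAt.continuousWithinAt
  have hinj' : ∀ i, InjOn (b i) (Ioo (lo i) (hi i)) := fun i t ht s hs h =>
    (hinj i i t ht s hs (by rw [h])).2
  have hD := isAddFundamentalDomain_iUnion_image hcont hinj hE hcov
  have hD' := isAddFundamentalDomain_Ioc hT 0
  rw [zero_add] at hD'
  have hinv : ∀ (g : AddSubgroup.zmultiples T) (x : ℝ), f (g +ᵥ x) = f x := by
    rintro ⟨_, n, rfl⟩ x
    rw [AddSubgroup.vadd_def, vadd_eq_add, add_comm]
    exact hper.zsmul n x
  -- Integrability is clear on `(0, T]` by compactness and passes to the union of the arcs, since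
  -- both are fundamental domains for the translations by `T` and `f` is invariant.
  have hint : IntegrableOn f (⋃ i, b i '' Ioo (lo i) (hi i)) :=
    (hD.integrableOn_iff hD' hinv).2
      ((hf.integrableOn_Icc (a := 0) (b := T)).mono_set Ioc_subset_Icc_self)
  have hint' : ∀ i, IntegrableOn f (b i '' Ioo (lo i) (hi i)) := fun i =>
    hint.mono_set (subset_iUnion (fun i => b i '' Ioo (lo i) (hi i)) i)
  have hw : ∀ i, ∀ t ∈ Ioo (lo i) (hi i),
      HasDerivWithinAt (b i) (b' i t) (Ioo (lo i) (hi i)) t := fun i t ht =>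
    (hderiv i t ht).hasDerivWithinAt
  refine ⟨fun i => (integrableOn_image_iff_integrableOn_abs_deriv_smul measurableSet_Ioo (hw i)
    (hinj' i) f).1 (hint' i), ?_⟩
  rw [intervalIntegral.integral_of_le hT.le, ← hD.setIntegral_eq hD' hinv,
    integral_iUnion_fintype (fun i =>
      measurableSet_Ioo.image_of_continuousOn_injOn (hcont i) (hinj' i)) ?_ hint']
  · refine Finset.sum_congr rfl fun i _ => ?_
    exact (integral_image_eq_integral_abs_deriv_smul measurableSet_Ioo (hw i) (hinj' i) f).symm
  · intro i j hij
    refine disjoint_left.2 ?_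
    rintro _ ⟨t, ht, rfl⟩ ⟨s, hs, h⟩
    exact hij (hinj i j t ht s hs (by rw [h])).1

/-! ### The total singular curvature -/

namespace Hedgehog

open FrontGeometry

/-- Two distinct times in the open interval give independent directions, both orthogonal to `(ρ,
ρ')`, which would then be zero. The endpoints must be excluded: if `ρ = 0`, both `0` and `π` are
zeros. -/
theorem singularFunction_unique {ρ : ℝ → ℝ} {θ : ℝ} (hreg : 0 < ρ θ ^ 2 + deriv ρ θ ^ 2)
    {α β : ℝ} (hα : α ∈ Ioo 0 Real.pi) (hβ : β ∈ Ioo 0 Real.pi)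
    (h1 : singularFunction ρ (α, θ) = 0) (h2 : singularFunction ρ (β, θ) = 0) : α = β := by
  simp only [singularFunction] at h1 h2
  have h3 : ρ θ * Real.sin (β - α) = 0 := by
    rw [Real.sin_sub]
    linear_combination Real.sin β * h1 - Real.sin α * h2
  have h4 : deriv ρ θ * Real.sin (β - α) = 0 := by
    rw [Real.sin_sub]
    linear_combination Real.cos α * h2 - Real.cos β * h1
  have h5 : Real.sin (β - α) = 0 := by
    by_contra h
    have h6 := (mul_eq_zero.1 h3).resolve_right h
    have h7 := (mul_eq_zero.1 h4).resolve_right h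
    rw [h6, h7] at hreg
    norm_num at hreg
  have := (Real.sin_eq_zero_iff_of_lt_of_lt (by linarith [hα.2, hβ.1])
    (by linarith [hα.1, hβ.2])).1 h5
  linarith

theorem exists_singularFunction_eq_zero {ρ : ℝ → ℝ} {θ : ℝ}
    (hreg : 0 < ρ θ ^ 2 + deriv ρ θ ^ 2) :
    ∃ α ∈ Icc 0 Real.pi, singularFunction ρ (α, θ) = 0 := by
  obtain ⟨a, ha, R, -, hx, hy⟩ := exists_polar_angle hreg
  refine ⟨a, ha, ?_⟩
  simp only [singularFunction]
  rw [hx, hy]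
  ring

/-- The projection of the arcs to the `θ`-circle is injective, by uniqueness of the singular time,
and misses only finitely many points, since some singular point lies over every `θ`. The sum over
the arcs thus becomes an integral over one period. -/
theorem totalCurvature_front {m : ℕ} {p : ℝ → ℝ} (hm : 0 < m) (hp : IsSupportFunction m p)
    (hreg : ∀ θ, 0 < rho p θ ^ 2 + deriv (rho p) θ ^ 2)
    (S : SingularArcs (front p) (frontNormal p) (period m)) :
    (∀ i, IntegrableOn (S.density i) (Ioo (S.lo i) (S.hi i))) ∧
      S.totalCurvature = -∫ θ in (0 : ℝ)..period m, singularDensity (rho p) θ := by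
  have hdiff : ∀ i, ∀ t ∈ Ioo (S.lo i) (S.hi i), DifferentiableAt ℝ (S.arc i) t :=
    fun i t ht => ((S.contDiff i).contDiffAt (isOpen_Ioo.mem_nhds ht)).differentiableAt (by simp)
  have hA2 := fun i t ht => (isA2Point_front_iff hp _).1 (S.isA2Point i t ht)
  have hsing : ∀ i, ∀ t ∈ Ioo (S.lo i) (S.hi i), singularFunction (rho p) (S.arc i t) = 0 :=
    fun i t ht => (hA2 i t ht).1
  have hdensity : ∀ i, EqOn (S.density i) (fun t => -(|(deriv (S.arc i) t).2| *
      singularDensity (rho p) (S.arc i t).2)) (Ioo (S.lo i) (S.hi i)) := fun i t ht =>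
    singularCurvature_mul_speed hp hreg (S.contDiff i) (hsing i) ht (S.regular i t ht)
      (hA2 i t ht).2
  have hIoo : ∀ i, ∀ t ∈ Ioo (S.lo i) (S.hi i), (S.arc i t).1 ∈ Ioo 0 Real.pi := fun i t ht =>
    arc_mem_Ioo ht (hdiff i t ht) (deriv_arc_ne_zero hp.contDiff_rho hreg ht (hdiff i t ht)
      (hsing i) (S.regular i t ht) (hA2 i t ht).2).1 (S.mem i)
  have hper := hp.periodic_rho
  have hinj : ∀ i j, ∀ t ∈ Ioo (S.lo i) (S.hi i), ∀ s ∈ Ioo (S.lo j) (S.hi j),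
      ((S.arc i t).2 : AddCircle (period m)) = (S.arc j s).2 → i = j ∧ t = s := by
    intro i j t ht s hs h
    refine S.inj i j t ht s hs (Prod.ext ?_ h)
    have h1 : rho p (S.arc j s).2 = rho p (S.arc i t).2 := by
      rw [← hper.lift_coe, ← hper.lift_coe]
      exact congrArg _ h.symm
    have h2 : deriv (rho p) (S.arc j s).2 = deriv (rho p) (S.arc i t).2 := by
      rw [← (periodic_deriv hper).lift_coe, ← (periodic_deriv hper).lift_coe]
      exact congrArg _ h.symm
    refine singularFunction_unique (hreg (S.arc i t).2) (hIoo i t ht) (hIoo j s hs)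
      (hsing i t ht) ?_
    change singularFunction (rho p) ((S.arc j s).1, (S.arc i t).2) = 0
    rw [← hsing j s hs]
    simp only [singularFunction, h1, h2]
  have hcov : ∀ x : ℝ, (x : AddCircle (period m)) ∉ Prod.snd ''
      (toAnnulus (period m) '' singularSet (front p) \
        ⋃ i, toAnnulus (period m) '' (S.arc i '' Ioo (S.lo i) (S.hi i))) →
      ∃ i, ∃ t ∈ Ioo (S.lo i) (S.hi i), ((S.arc i t).2 : AddCircle (period m)) = x := by
    intro x hx
    obtain ⟨α, hα, h0⟩ := exists_singularFunction_eq_zero (hreg x)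
    by_contra hno
    refine hx ⟨toAnnulus (period m) (α, x),
      ⟨⟨(α, x), ⟨hα, (isSingular_front_iff hp _).2 h0⟩, rfl⟩, fun hmem => hno ?_⟩, rfl⟩
    obtain ⟨i, _, ⟨t, ht, rfl⟩, h⟩ := mem_iUnion.1 hmem
    exact ⟨i, t, ht, congrArg Prod.snd h⟩
  obtain ⟨hint, hsum⟩ := sum_integral_arcs (period_pos hm)
    (fun i t ht => (hdiff i t ht).hasDerivAt.snd) hinj (S.cover.image Prod.snd) hcov
    (continuous_singularDensity hp.contDiff_rho hreg) (periodic_singularDensity hper)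
  refine ⟨fun i => (integrableOn_congr_fun (hdensity i) measurableSet_Ioo).2 (hint i).neg, ?_⟩
  rw [← hsum, SingularArcs.totalCurvature, ← Finset.sum_neg_distrib]
  refine Finset.sum_congr rfl fun i _ => ?_
  rw [setIntegral_congr_fun measurableSet_Ioo (hdensity i), integral_neg]


/-! ### Consequences of genericity -/

section Generic

variable {m : ℕ} {p : ℝ → ℝ}

theorem hasDerivAt_curve (hp : IsSupportFunction m p) (θ : ℝ) :
    HasDerivAt (curve p) !₂[-(rho p θ * Real.sin θ), rho p θ * Real.cos θ] θ := by
  have h0 := hasDerivAt_of_contDiff hp.smooth θ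
  have h1 := hasDerivAt_of_contDiff hp.contDiff_deriv θ
  have hs := Real.hasDerivAt_sin θ
  have hc := Real.hasDerivAt_cos θ
  refine HasDerivAt.vec2 ?_ ?_
  · convert! (h0.mul hc).sub (h1.mul hs) using 1
    rw [rho]
    ring
  · convert! (h0.mul hs).add (h1.mul hc) using 1
    rw [rho]
    ring

/-- Since `f' = ρ 𝕥`, a common zero of `ρ` and `ρ'` would annihilate `f'` and `f''`, contradicting
the cusp condition. -/
theorem rho_regular (hp : IsSupportFunction m p)
    (hcusp : PlaneCurve.AtMostCusps (curve p)) (θ : ℝ) :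
    0 < rho p θ ^ 2 + deriv (rho p) θ ^ 2 := by
  by_contra hle
  have h0 : rho p θ = 0 := by nlinarith [sq_nonneg (rho p θ), sq_nonneg (deriv (rho p) θ)]
  have h1 : deriv (rho p) θ = 0 := by
    nlinarith [sq_nonneg (rho p θ), sq_nonneg (deriv (rho p) θ)]
  have hd : deriv (curve p) = fun θ => !₂[-(rho p θ * Real.sin θ), rho p θ * Real.cos θ] :=
    funext fun θ => (hasDerivAt_curve hp θ).deriv
  have hr := hasDerivAt_of_contDiff hp.contDiff_rho θ
  have hd2 : iteratedDeriv 2 (curve p) θ = 0 := by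
    rw [iteratedDeriv_succ, iteratedDeriv_one, hd]
    refine (HasDerivAt.vec2 (hr.mul (Real.hasDerivAt_sin θ)).neg
      (hr.mul (Real.hasDerivAt_cos θ))).deriv.trans ?_
    ext i
    fin_cases i <;> simp [h0, h1]
  have hz : deriv (curve p) θ = 0 := by
    rw [hd]
    ext i
    fin_cases i <;> simp [h0]
  exact (hcusp θ hz).2.ne_zero 0 hd2

/-- The function whose zeros are the singular points of the singular evolutoids set. -/
noncomputable def cuspFunction (ρ : ℝ → ℝ) (θ : ℝ) : ℝ :=
  ρ θ * (ρ θ * deriv (deriv ρ) θ - deriv ρ θ ^ 2)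

theorem differentiable_cuspFunction {ρ : ℝ → ℝ} (hρ : ContDiff ℝ ∞ ρ) :
    Differentiable ℝ (cuspFunction ρ) := by
  have h0 := hρ.differentiable (by simp)
  have h1 := (contDiff_deriv_of_contDiff hρ).differentiable (by simp)
  have h2 := (contDiff_deriv_of_contDiff (contDiff_deriv_of_contDiff hρ)).differentiable (by simp)
  unfold cuspFunction
  fun_prop

theorem singularEvolutoids_eq (p : ℝ → ℝ) : singularEvolutoids p = fun θ =>
    !₂[p θ * Real.cos θ - deriv p θ * Real.sin θ +
        (rho p θ ^ 2 * deriv (rho p) θ * Real.sin θ - rho p θ ^ 3 * Real.cos θ) /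
          (rho p θ ^ 2 + deriv (rho p) θ ^ 2),
      p θ * Real.sin θ + deriv p θ * Real.cos θ +
        (-(rho p θ ^ 2 * deriv (rho p) θ * Real.cos θ) - rho p θ ^ 3 * Real.sin θ) /
          (rho p θ ^ 2 + deriv (rho p) θ ^ 2)] := by
  funext θ
  ext i
  fin_cases i
  · simp [singularEvolutoids, curve, tangent, normal]
    ring
  · simp [singularEvolutoids, curve, tangent, normal]
    ring

theorem hasDerivAt_singularEvolutoids (hp : IsSupportFunction m p)
    (hreg : ∀ θ, 0 < rho p θ ^ 2 + deriv (rho p) θ ^ 2) (θ : ℝ) :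
    HasDerivAt (singularEvolutoids p)
      !₂[cuspFunction (rho p) θ * (((rho p θ ^ 2 - deriv (rho p) θ ^ 2) * Real.sin θ +
          2 * rho p θ * deriv (rho p) θ * Real.cos θ) /
            (rho p θ ^ 2 + deriv (rho p) θ ^ 2) ^ 2),
        cuspFunction (rho p) θ * (((deriv (rho p) θ ^ 2 - rho p θ ^ 2) * Real.cos θ +
          2 * rho p θ * deriv (rho p) θ * Real.sin θ) /
            (rho p θ ^ 2 + deriv (rho p) θ ^ 2) ^ 2)] θ := by
  have h0 := hasDerivAt_of_contDiff hp.smooth θ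
  have h1 := hasDerivAt_of_contDiff hp.contDiff_deriv θ
  have r0 := hasDerivAt_of_contDiff hp.contDiff_rho θ
  have r1 := hasDerivAt_of_contDiff (contDiff_deriv_of_contDiff hp.contDiff_rho) θ
  have hs := Real.hasDerivAt_sin θ
  have hc := Real.hasDerivAt_cos θ
  have hr : deriv (deriv p) θ = rho p θ - p θ := by simp [rho]
  have hne := (hreg θ).ne'
  rw [singularEvolutoids_eq]
  refine HasDerivAt.vec2 ?_ ?_
  · convert! ((h0.mul hc).sub (h1.mul hs)).add (((((r0.pow 2).mul r1).mul hs).sub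
      ((r0.pow 3).mul hc)).div ((r0.pow 2).add (r1.pow 2)) hne) using 1
    simp only [Pi.mul_apply, Pi.pow_apply, Pi.add_apply, Pi.sub_apply]
    rw [hr, cuspFunction]
    push_cast
    field_simp
    ring
  · convert! ((h0.mul hs).add (h1.mul hc)).add (((((r0.pow 2).mul r1).mul hc).neg.sub
      ((r0.pow 3).mul hs)).div ((r0.pow 2).add (r1.pow 2)) hne) using 1
    simp only [Pi.mul_apply, Pi.pow_apply, Pi.add_apply, Pi.sub_apply, Pi.neg_apply]
    rw [hr, cuspFunction]
    push_cast
    field_simp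
    ring

/-- The velocity of the singular evolutoids set is `h V`, where `h` is the cusp function and `V` a
differentiable vector field. Where `h = 0` the second derivative is `h' V`, and at a cusp this is
nonzero. -/
theorem deriv_cuspFunction_ne_zero (hp : IsSupportFunction m p)
    (hreg : ∀ θ, 0 < rho p θ ^ 2 + deriv (rho p) θ ^ 2)
    (hcusp : PlaneCurve.AtMostCusps (singularEvolutoids p)) {θ : ℝ}
    (hθ : cuspFunction (rho p) θ = 0) : deriv (cuspFunction (rho p)) θ ≠ 0 := by
  intro h
  have hd : deriv (singularEvolutoids p) = _ :=
    funext fun θ => (hasDerivAt_singularEvolutoids hp hreg θ).deriv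
  have hz : deriv (singularEvolutoids p) θ = 0 := by
    rw [hd]
    ext i
    fin_cases i <;> simp [hθ]
  refine (hcusp θ hz).2.ne_zero 0 ?_
  have r0 := hp.contDiff_rho.differentiable (by simp)
  have r1 := (contDiff_deriv_of_contDiff hp.contDiff_rho).differentiable (by simp)
  have hh := (differentiable_cuspFunction hp.contDiff_rho θ).hasDerivAt
  have hne : ((rho p θ ^ 2 + deriv (rho p) θ ^ 2) ^ 2) ≠ 0 := pow_ne_zero _ (hreg θ).ne'
  have d1 : DifferentiableAt ℝ (fun θ => ((rho p θ ^ 2 - deriv (rho p) θ ^ 2) * Real.sin θ +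
          2 * rho p θ * deriv (rho p) θ * Real.cos θ) /
            (rho p θ ^ 2 + deriv (rho p) θ ^ 2) ^ 2) θ :=
    DifferentiableAt.fun_div (by fun_prop) (by fun_prop) hne
  have d2 : DifferentiableAt ℝ (fun θ => ((deriv (rho p) θ ^ 2 - rho p θ ^ 2) * Real.cos θ +
          2 * rho p θ * deriv (rho p) θ * Real.sin θ) /
            (rho p θ ^ 2 + deriv (rho p) θ ^ 2) ^ 2) θ :=
    DifferentiableAt.fun_div (by fun_prop) (by fun_prop) hne
  change iteratedDeriv 2 (singularEvolutoids p) θ = 0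
  rw [iteratedDeriv_succ, iteratedDeriv_one, hd]
  refine (HasDerivAt.vec2 (hh.mul d1.hasDerivAt) (hh.mul d2.hasDerivAt)).deriv.trans ?_
  rw [hθ, h]
  ext i
  fin_cases i <;> simp

end Generic

/-! ### The singular set consists of finitely many arcs and points -/

theorem finite_zeros_of_deriv_ne_zero {f : ℝ → ℝ} (hf : Differentiable ℝ f)
    (h : ∀ x, f x = 0 → deriv f x ≠ 0) (a b : ℝ) : {x ∈ Icc a b | f x = 0}.Finite := by
  by_contra hinf
  obtain ⟨x, -, hx⟩ := Set.Infinite.exists_accPt_of_subset_isCompact hinf isCompact_Icc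
    (sep_subset _ _)
  have hev : ∀ᶠ z in 𝓝[≠] x, f z ≠ 0 := by
    by_cases h0 : f x = 0
    · exact (hf x).hasDerivAt.eventually_ne (h x h0)
    · exact ((hf x).continuousAt.eventually_ne h0).filter_mono nhdsWithin_le_nhds
  rw [accPt_iff_frequently_nhdsNE] at hx
  obtain ⟨z, hz, hz'⟩ := (hx.and_eventually hev).exists
  exact hz' hz.2

/-- The gaps are indexed by their left endpoints, the elements of `Z` in `[a, b)`; each right
endpoint is the next element of `Z`. -/
theorem exists_gaps (Z : Finset ℝ) {a b : ℝ} (ha : a ∈ Z) (hb : b ∈ Z) :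
    ∃ (n : ℕ) (lo hi : Fin n → ℝ), (∀ i, lo i < hi i) ∧
      (∀ i, ∀ x ∈ Ioo (lo i) (hi i), x ∈ Ioo a b ∧ x ∉ Z) ∧
      (∀ i j x, x ∈ Ioo (lo i) (hi i) → x ∈ Ioo (lo j) (hi j) → i = j) ∧
      ∀ x ∈ Ioo a b, x ∉ Z → ∃ i, x ∈ Ioo (lo i) (hi i) := by
  set L : Finset ℝ := Z.filter fun z => a ≤ z ∧ z < b with hL
  have hne : ∀ z : L, (Z.filter fun y => (z : ℝ) < y).Nonempty := fun z =>
    ⟨b, Finset.mem_filter.2 ⟨hb, (Finset.mem_filter.1 z.2).2.2⟩⟩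
  set next : L → ℝ := fun z => (Z.filter fun y => (z : ℝ) < y).min' (hne z) with hnext
  have hnext_mem : ∀ z, next z ∈ Z ∧ (z : ℝ) < next z := fun z =>
    Finset.mem_filter.1 (Finset.min'_mem _ (hne z))
  have hnext_le : ∀ (z : L) (y : ℝ), y ∈ Z → (z : ℝ) < y → next z ≤ y := fun z y hy hzy =>
    Finset.min'_le _ _ (Finset.mem_filter.2 ⟨hy, hzy⟩)
  have hL' : ∀ z : L, (z : ℝ) ∈ Z ∧ a ≤ z ∧ (z : ℝ) < b := fun z => Finset.mem_filter.1 z.2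
  have huniq : ∀ (z w : L) (x : ℝ), x ∈ Ioo (z : ℝ) (next z) → x ∈ Ioo (w : ℝ) (next w) →
      ¬ (z : ℝ) < w := fun z w x hz hw hlt => by
    linarith [hnext_le z w (hL' w).1 hlt, hz.2, hw.1]
  let e := L.equivFin
  refine ⟨L.card, fun i => e.symm i, fun i => next (e.symm i), fun i => (hnext_mem _).2,
    fun i x hx => ⟨⟨?_, ?_⟩, fun hxZ => ?_⟩, fun i j x hi hj => ?_, fun x hx hxZ => ?_⟩
  · exact (hL' (e.symm i)).2.1.trans_lt hx.1
  · exact hx.2.trans_le (hnext_le _ b hb (hL' (e.symm i)).2.2)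
  · exact (hnext_le _ x hxZ hx.1).not_gt hx.2
  · refine e.symm.injective (Subtype.ext (le_antisymm ?_ ?_))
    · exact not_lt.1 (huniq _ _ x hj hi)
    · exact not_lt.1 (huniq _ _ x hi hj)
  · have hne' : (Z.filter fun y => y < x).Nonempty := ⟨a, Finset.mem_filter.2 ⟨ha, hx.1⟩⟩
    set z := (Z.filter fun y => y < x).max' hne' with hz
    have hzm := Finset.mem_filter.1 (Finset.max'_mem _ hne')
    have hzL : z ∈ L := Finset.mem_filter.2 ⟨hzm.1,
      Finset.le_max' _ _ (Finset.mem_filter.2 ⟨ha, hx.1⟩), hzm.2.trans hx.2⟩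
    refine ⟨e ⟨z, hzL⟩, ?_⟩
    simp only [Equiv.symm_apply_apply]
    refine ⟨hzm.2, lt_of_not_ge fun hle => ?_⟩
    have h1 := hnext_mem ⟨z, hzL⟩
    have h2 : next ⟨z, hzL⟩ < x := lt_of_le_of_ne hle fun h => hxZ (h ▸ h1.1)
    exact (Finset.le_max' _ _ (Finset.mem_filter.2 ⟨h1.1, h2⟩)).not_gt h1.2

section Existence

open FrontGeometry

variable {ρ : ℝ → ℝ}

theorem finite_singularFunction_zeros (hreg : ∀ θ, 0 < ρ θ ^ 2 + deriv ρ θ ^ 2) (θ : ℝ) :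
    {α ∈ Icc 0 Real.pi | singularFunction ρ (α, θ) = 0}.Finite := by
  have h : {α ∈ Ioo 0 Real.pi | singularFunction ρ (α, θ) = 0}.Subsingleton :=
    fun α hα β hβ => singularFunction_unique (hreg θ) hα.1 hβ.1 hα.2 hβ.2
  refine (h.finite.union (Set.toFinite {0, Real.pi})).subset ?_
  rintro α ⟨⟨h0, hπ⟩, hα⟩
  rcases h0.eq_or_lt with h1 | h1
  · exact Or.inr (Or.inl h1.symm)
  · rcases hπ.eq_or_lt with h2 | h2
    · exact Or.inr (Or.inr h2)
    · exact Or.inl ⟨⟨h1, h2⟩, hα⟩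

/-- The time at which the evolutoid is singular at a parameter with `ρ ≠ 0`. -/
noncomputable def singularTime (ρ : ℝ → ℝ) (θ : ℝ) : ℝ :=
  Real.pi / 2 + Real.arctan (deriv ρ θ / ρ θ)

theorem singularTime_mem_Ioo (ρ : ℝ → ℝ) (θ : ℝ) : singularTime ρ θ ∈ Ioo 0 Real.pi := by
  have h1 := Real.neg_pi_div_two_lt_arctan (deriv ρ θ / ρ θ)
  have h2 := Real.arctan_lt_pi_div_two (deriv ρ θ / ρ θ)
  constructor <;> unfold singularTime <;> linarith

theorem cos_singularTime (ρ : ℝ → ℝ) (θ : ℝ) : Real.cos (singularTime ρ θ) =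
    -(deriv ρ θ / ρ θ * Real.sin (singularTime ρ θ)) := by
  rw [singularTime, add_comm, Real.cos_add_pi_div_two, Real.sin_add_pi_div_two]
  have h := Real.tan_mul_cos (Real.cos_arctan_pos (deriv ρ θ / ρ θ)).ne'
  rw [Real.tan_arctan] at h
  rw [h]

theorem singularFunction_singularTime {θ : ℝ} (h : ρ θ ≠ 0) :
    singularFunction ρ (singularTime ρ θ, θ) = 0 := by
  simp only [singularFunction, cos_singularTime]
  field_simp
  ring

/-- Eliminating the cosine turns the expression into `(ρ ρ'' - ρ'²) sin α / ρ`. Hence the `A₂`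
condition fails over `ρ ≠ 0` exactly at singular points of the singular evolutoids set. -/
theorem singularFunction_deriv_singularTime {θ : ℝ} (h : cuspFunction ρ θ ≠ 0) :
    deriv ρ θ * Real.cos (singularTime ρ θ) +
      deriv (deriv ρ) θ * Real.sin (singularTime ρ θ) ≠ 0 := by
  rw [cuspFunction, mul_ne_zero_iff] at h
  have hs := Real.sin_pos_of_mem_Ioo (singularTime_mem_Ioo ρ θ)
  have h0 := h.1
  have e : deriv ρ θ * Real.cos (singularTime ρ θ) +
      deriv (deriv ρ) θ * Real.sin (singularTime ρ θ) =
      (ρ θ * deriv (deriv ρ) θ - deriv ρ θ ^ 2) * Real.sin (singularTime ρ θ) / ρ θ := by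
    rw [cos_singularTime]
    field_simp
    ring
  rw [e]
  exact div_ne_zero (mul_ne_zero h.2 hs.ne') h0

theorem contDiffAt_singularTime (hρ : ContDiff ℝ ∞ ρ) {θ : ℝ} (h : ρ θ ≠ 0) :
    ContDiffAt ℝ 2 (singularTime ρ) θ := by
  have h0 : ContDiffAt ℝ 2 ρ θ := (contDiff_infty.1 hρ 2).contDiffAt
  have h1 : ContDiffAt ℝ 2 (deriv ρ) θ :=
    (contDiff_infty.1 (contDiff_deriv_of_contDiff hρ) 2).contDiffAt
  exact contDiffAt_const.add (Real.contDiff_arctan.contDiffAt.comp θ (h1.div h0 h))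

/-- The arcs are the graphs of `singularTime` over the gaps between zeros of the cusp function: `ρ ≠
0` makes the graph smooth, and the other factor gives `A₂`. All remaining singular points lie over
the finite set `Z`, finitely many over each `θ`. -/
theorem nonempty_singularArcs_front {m : ℕ} {p : ℝ → ℝ} (hm : 0 < m) (hp : IsSupportFunction m p)
    (hgen : IsGeneric p) :
    Nonempty (SingularArcs (front p) (frontNormal p) (period m)) := by
  have hreg := rho_regular hp hgen.curve_cusps
  have hT := period_pos hm
  have : Fact (0 < period m) := ⟨hT⟩
  have hfin := finite_zeros_of_deriv_ne_zero (differentiable_cuspFunction hp.contDiff_rho)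
    (fun θ hθ => deriv_cuspFunction_ne_zero hp hreg hgen.ses_cusps hθ) 0 (period m)
  -- The ends of the period are added so that the gaps lie inside one period.
  set Z : Finset ℝ := insert 0 (insert (period m) hfin.toFinset) with hZ
  have hZ0 : (0 : ℝ) ∈ Z := by simp [hZ]
  have hcusp : ∀ θ ∈ Ioo 0 (period m), θ ∉ Z → cuspFunction (rho p) θ ≠ 0 := by
    intro θ hθ hθZ h
    exact hθZ (Finset.mem_insert_of_mem (Finset.mem_insert_of_mem
      (hfin.mem_toFinset.2 ⟨Ioo_subset_Icc_self hθ, h⟩)))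
  obtain ⟨n, lo, hi, hlt, hgap, huniq, hcov⟩ :=
    exists_gaps Z hZ0 (show period m ∈ Z by simp [hZ])
  have hcusp' : ∀ i, ∀ t ∈ Ioo (lo i) (hi i), cuspFunction (rho p) t ≠ 0 := fun i t ht =>
    hcusp t (hgap i t ht).1 (hgap i t ht).2
  have hrho : ∀ i, ∀ t ∈ Ioo (lo i) (hi i), rho p t ≠ 0 := fun i t ht =>
    (mul_ne_zero_iff.1 (hcusp' i t ht)).1
  have hsmooth : ∀ i, ∀ t ∈ Ioo (lo i) (hi i),
      ContDiffAt ℝ 2 (fun t => (singularTime (rho p) t, t)) t := fun i t ht =>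
    (contDiffAt_singularTime hp.contDiff_rho (hrho i t ht)).prodMk contDiffAt_id
  refine ⟨⟨n, lo, hi, fun _ t => (singularTime (rho p) t, t), hlt, fun i t ht =>
    (hsmooth i t ht).contDiffWithinAt, fun i t ht h => ?_, fun i t ht => ?_, fun i t ht => ?_,
    fun i j t ht s hs h => ?_, ?_⟩⟩
  · have h1 : HasDerivAt (fun s : ℝ => s) (deriv (fun t => (singularTime (rho p) t, t)) t).2 t :=
      ((hsmooth i t ht).differentiableAt (by simp)).hasDerivAt.snd
    have h2 := h1.unique (hasDerivAt_id' t)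
    rw [h] at h2
    exact zero_ne_one h2
  · exact ⟨Ioo_subset_Icc_self (singularTime_mem_Ioo _ _),
      (isSingular_front_iff hp _).2 (singularFunction_singularTime (hrho i t ht))⟩
  · exact (isA2Point_front_iff hp _).2 ⟨singularFunction_singularTime (hrho i t ht),
      singularFunction_deriv_singularTime (hcusp' i t ht)⟩
  · have h1 : (t : AddCircle (period m)) = s := congrArg Prod.snd h
    have hmem : ∀ i, ∀ t ∈ Ioo (lo i) (hi i), t ∈ Ico 0 (0 + period m) := fun i t ht => by
      rw [zero_add]
      exact Ioo_subset_Ico_self (hgap i t ht).1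
    obtain rfl := (AddCircle.coe_eq_coe_iff_of_mem_Ico (hmem i t ht) (hmem j s hs)).1 h1
    exact ⟨huniq i j t ht hs, rfl⟩
  · refine (Z.finite_toSet.biUnion fun θ _ => (finite_singularFunction_zeros hreg θ).image
      fun α => toAnnulus (period m) (α, θ)).subset ?_
    rintro _ ⟨⟨⟨α, θ⟩, ⟨hα, hsing⟩, rfl⟩, hno⟩
    rw [isSingular_front_iff hp] at hsing
    -- A singular point is moved into the fundamental period. If its parameter is then outside `Z`,
    -- it lies on one of the graphs.
    obtain ⟨n, hn, -⟩ := existsUnique_add_zsmul_mem_Ico hT θ 0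
    rw [zero_add] at hn
    set θ' := θ + n • period m with hθ'
    have hcoe : ((θ' : ℝ) : AddCircle (period m)) = θ := by
      have : ((n • period m : ℝ) : AddCircle (period m)) = 0 :=
        (AddCircle.coe_eq_zero_iff _).2 ⟨n, rfl⟩
      rw [hθ', AddCircle.coe_add, this, add_zero]
    have hpt : toAnnulus (period m) (α, θ) = toAnnulus (period m) (α, θ') :=
      Prod.ext rfl hcoe.symm
    have hsing' : singularFunction (rho p) (α, θ') = 0 := by
      have h1 : rho p θ' = rho p θ := hp.periodic_rho.zsmul n θ
      have h2 : deriv (rho p) θ' = deriv (rho p) θ := (periodic_deriv hp.periodic_rho).zsmul n θ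
      rw [← hsing]
      simp only [singularFunction, h1, h2]
    rw [hpt] at hno ⊢
    have hθZ : θ' ∈ Z := by
      by_contra hθZ
      have hpos : θ' ∈ Ioo 0 (period m) :=
        ⟨lt_of_le_of_ne hn.1 fun h => hθZ (h ▸ hZ0), hn.2⟩
      obtain ⟨i, hi⟩ := hcov θ' hpos hθZ
      have hr := hrho i θ' hi
      -- At `α = 0` and `α = π` the singular function equals `±ρ`, which is nonzero in a gap.
      have hα' : α ∈ Ioo 0 Real.pi := by
        refine ⟨lt_of_le_of_ne hα.1 fun h => ?_, lt_of_le_of_ne hα.2 fun h => ?_⟩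
        · simp [singularFunction, ← h, hr] at hsing'
        · simp [singularFunction, h, hr] at hsing'
      have heq := singularFunction_unique (hreg θ') hα' (singularTime_mem_Ioo _ _) hsing'
        (singularFunction_singularTime hr)
      exact hno (mem_iUnion.2 ⟨i, (α, θ'), ⟨θ', hi, by rw [heq]⟩, rfl⟩)
    exact mem_iUnion₂.2 ⟨θ', hθZ, α, ⟨hα, hsing'⟩, rfl⟩

end Existence

end Hedgehog

/-! ### The Gauss–Bonnet type formula for the front -/

open FrontGeometry in
theorem mainTheorem2 (m : ℕ) (hm : 0 < m) (p : ℝ → ℝ)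
    (hp : Hedgehog.IsSupportFunction m p) (hgen : Hedgehog.IsGeneric p) :
    IntegrableOn (curvatureDensity (Hedgehog.front p) (Hedgehog.frontNormal p))
        (fundamentalDomain (Hedgehog.period m)) ∧
      Nonempty (SingularArcs (Hedgehog.front p) (Hedgehog.frontNormal p) (Hedgehog.period m)) ∧
      ∀ S : SingularArcs (Hedgehog.front p) (Hedgehog.frontNormal p) (Hedgehog.period m),
        (∀ i, IntegrableOn (S.density i) (Ioo (S.lo i) (S.hi i))) ∧
          ∫ q in fundamentalDomain (Hedgehog.period m),
              curvatureDensity (Hedgehog.front p) (Hedgehog.frontNormal p) q =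
            -2 * S.totalCurvature := by
  have hreg := Hedgehog.rho_regular hp hgen.curve_cusps
  refine ⟨Hedgehog.integrableOn_curvatureDensity_front hp,
    Hedgehog.nonempty_singularArcs_front hm hp hgen, fun S => ?_⟩
  obtain ⟨hint, htotal⟩ := Hedgehog.totalCurvature_front hm hp hreg S
  refine ⟨hint, ?_⟩
  rw [Hedgehog.integral_curvatureDensity_front hm hp hreg,
    Hedgehog.integral_curvature_eq_integral_singularDensity hp.contDiff_rho hreg hp.periodic_rho,
    htotal]
  ring
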